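/- **Setting.** Four agents $x_1,\dots,x_4\in\mathbb R^2$ form the 2-cycles formation. Put $z_1=x_2-x_1$, $z_2=x_3-x_2$, $z_3=x_1-x_3$, $z_4=x_3-x_4$, $z_5=x_4-x_1$. A target is $\mu=[\bar x_2,\bar x_3,\bar x_4]\in(\mathbb R^2)^3$ (with $\bar x_1=0$); its edge lengths are $d_1=\|\bar x_2-\bar x_1\|$, $d_2=\|\bar x_3-\bar x_2\|$, $d_3=\|\bar x_1-\bar x_3\|$, $d_4=\|\bar x_3-\bar x_4\|$, $d_5=\|\bar x_4-\bar x_1\|$. The agents observe $$h_1(x)=(\|z_1\|,\|z_5\|,z_1^Tz_5),\quad h_2(x)=\|z_2\|,\quad h_3(x)=\|z_3\|,\quad h_4(x)=\|z_4\|,$$ and know about the target $$\delta_1(\mu)=(d_1,d_5),\quad \delta_2(\mu)=d_2,\quad \delta_3(\mu)=d_3,\quad \delta_4(\mu)=d_4 .$$ A feedback law $u=(u_{11},u_{12},u_2,u_3,u_4)\in\mathcal U$ consists of smooth real-valued functions of the arguments shown in $$\dot x_1=u_{11}(\delta_1(\mu);h_1(x))\,z_1+u_{12}(\delta_1(\mu);h_1(x))\,z_5,\qquad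 \dot x_i=u_i(\delta_i(\mu);h_i(x))\,z_i\quad(i=2,3,4).$$ $\mathcal U$ carries the (Whitney) $C^r$ topology, $0\le r\le\infty$. The system is considered on the space $M$ of configurations modulo rotations and translations. For given $u$ and $\mu$, $\mathcal E$ is the set of equilibria on $M$ (that is, of configurations whose velocity is that of an infinitesimal rigid motion); $\mathcal E_s\subset\mathcal E$ is the set of those at which the linearization on $M$ exists and has only eigenvalues with negative real part; $\mathcal E_d$ is the set of all frameworks with $\|z_i\|=d_i$, $i=1,\dots,5$; and $\mathcal E_a=\mathcal E\setminus\mathcal E_d$ is the set of ancillary equilibria. (At the class of coinciding agents, the linearization is taken modulo translations.) The law $u$ makes the formation *type-A stable* if for almost every target $\mu$ one has $\mathcal E_s\neq\varnothing$ and $\mathcal E_s\subset\mathcal E_d$. A property of feedback laws holds *robustly* at $u$ if it holds for all $u'$ in a neighborhood of $u$ in $\mathcal U$. **Theorem.** (1) For every $r$, there is no $u\in\mathcal U$ which robustly makes the 2-cycles formation type-A stable. (2) Moreover, for every $u\in\mathcal U$, robust or not, there is a nonempty open set $O$ of targets such that, for every $\mu\in O$, if the system has a stable equilibrium at all, then it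 has a stable ancillary equilibrium: $\mathcal E_s\ne\varnothing$ implies $\mathcal E_s\cap\mathcal E_a\neq\varnothing$. -/

import Mathlib

open MeasureTheory Topology
open scoped ContDiff

namespace TwoCycles

noncomputable section

/-! ### The state space and the 2-cycles formation -/

/-- The plane with its Euclidean norm. -/
abbrev Plane := EuclideanSpace ℝ (Fin 2)

/-- Positions `x₁, x₂, x₃, x₄` of the four agents (agent `i` has index `i - 1`). -/
abbrev Configuration := Fin 4 → Plane

/-- A target `μ = [x̄₂, x̄₃, x̄₄]`; the first target point is `x̄₁ = 0`. -/
abbrev Target := Fin 3 → Plane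

def z1 (x : Configuration) : Plane := x 1 - x 0
def z2 (x : Configuration) : Plane := x 2 - x 1
def z3 (x : Configuration) : Plane := x 0 - x 2
def z4 (x : Configuration) : Plane := x 2 - x 3
def z5 (x : Configuration) : Plane := x 3 - x 0

/-- The framework described by the target `μ`. -/
def Target.framework (μ : Target) : Configuration := ![0, μ 0, μ 1, μ 2]

/-- The target edge lengths `d₁, …, d₅`. -/
def d1 (μ : Target) : ℝ := ‖z1 μ.framework‖
def d2 (μ : Target) : ℝ := ‖z2 μ.framework‖
def d3 (μ : Target) : ℝ := ‖z3 μ.framework‖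
def d4 (μ : Target) : ℝ := ‖z4 μ.framework‖
def d5 (μ : Target) : ℝ := ‖z5 μ.framework‖

/-- What each agent observes about the state. -/
def h1 (x : Configuration) : ℝ × ℝ × ℝ := (‖z1 x‖, ‖z5 x‖, inner ℝ (z1 x) (z5 x))
def h2 (x : Configuration) : ℝ := ‖z2 x‖
def h3 (x : Configuration) : ℝ := ‖z3 x‖
def h4 (x : Configuration) : ℝ := ‖z4 x‖

/-- What each agent knows about the target. -/
def δ1 (μ : Target) : ℝ × ℝ := (d1 μ, d5 μ)
def δ2 (μ : Target) : ℝ := d2 μ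
def δ3 (μ : Target) : ℝ := d3 μ
def δ4 (μ : Target) : ℝ := d4 μ

/-! ### Feedback laws, and the `C^r` topology on them -/

/-- Smooth real-valued functions on `E`. -/
def SmoothFn (E : Type) [NormedAddCommGroup E] [NormedSpace ℝ E] : Type :=
  {f : E → ℝ // ContDiff ℝ ∞ f}

/-- `g` and all its derivatives up to order `k` are `ε`-close to those of `f`, pointwise. -/
def CloseUpTo {E : Type} [NormedAddCommGroup E] [NormedSpace ℝ E]
    (k : ℕ) (ε : E → ℝ) (f g : SmoothFn E) : Prop :=
  ∀ j ≤ k, ∀ p : E, ‖iteratedFDeriv ℝ j g.1 p - iteratedFDeriv ℝ j f.1 p‖ < ε p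

/-- The Whitney `C^r` topology, `0 ≤ r ≤ ∞`. It is finer than the topologies of uniform and of
locally uniform convergence of the derivatives up to order `r`, so that a property which holds
robustly for one of these holds robustly for this one. -/
abbrev crTopology (E : Type) [NormedAddCommGroup E] [NormedSpace ℝ E] (r : ℕ∞) :
    TopologicalSpace (SmoothFn E) :=
  TopologicalSpace.generateFrom
    {W | ∃ (k : ℕ) (f : SmoothFn E) (ε : E → ℝ), (k : ℕ∞) ≤ r ∧ Continuous ε ∧ (∀ p, 0 < ε p) ∧
      W = {g | CloseUpTo k ε f g}}

/-- A decentralized feedback law: `u₁₁, u₁₂` are smooth functions of `(δ₁(μ); h₁(x))`, and `uᵢ` is a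
smooth function of `(δᵢ(μ); hᵢ(x))` for `i = 2, 3, 4`. -/
structure Feedback where
  u11 : SmoothFn ((ℝ × ℝ) × (ℝ × ℝ × ℝ))
  u12 : SmoothFn ((ℝ × ℝ) × (ℝ × ℝ × ℝ))
  u2 : SmoothFn (ℝ × ℝ)
  u3 : SmoothFn (ℝ × ℝ)
  u4 : SmoothFn (ℝ × ℝ)

/-- The `C^r` topology on feedback laws (the product topology over the five components). -/
abbrev Feedback.crTopology (r : ℕ∞) : TopologicalSpace Feedback :=
  .induced Feedback.u11 (TwoCycles.crTopology _ r) ⊓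
  .induced Feedback.u12 (TwoCycles.crTopology _ r) ⊓
  .induced Feedback.u2 (TwoCycles.crTopology _ r) ⊓
  .induced Feedback.u3 (TwoCycles.crTopology _ r) ⊓
  .induced Feedback.u4 (TwoCycles.crTopology _ r)

/-- An element `u` of a topological space satisfies `P` robustly if `P` holds on a neighborhood
of `u`. -/
def Robustly {S : Type} (τ : TopologicalSpace S) (P : S → Prop) (u : S) : Prop :=
  ∃ N ∈ @nhds S τ u, ∀ v ∈ N, P v

/-- The closed-loop dynamics: the right-hand side of `ẋ = velocity u μ x`. -/
def velocity (u : Feedback) (μ : Target) (x : Configuration) : Configuration :=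
  ![u.u11.1 (δ1 μ, h1 x) • (x 1 - x 0) + u.u12.1 (δ1 μ, h1 x) • (x 3 - x 0),
    u.u2.1 (δ2 μ, h2 x) • (x 2 - x 1),
    u.u3.1 (δ3 μ, h3 x) • (x 0 - x 2),
    u.u4.1 (δ4 μ, h4 x) • (x 2 - x 3)]

/-! ### Equilibria up to rotation and translation

The dynamics commutes with rotations and translations and is considered on the quotient `M` of the
set of configurations. Subsets of `M` are represented by subsets of `Configuration` that are
invariant under rotations and translations. -/

/-- Rotation by a quarter turn. -/
def quarterTurn (v : Plane) : Plane := !₂[-v 1, v 0]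

/-- The velocity of `x` under the infinitesimal rigid motion of angular velocity `a` and
translational velocity `b`. -/
def rigidVelocity (a : ℝ) (b : Plane) (x : Configuration) : Configuration :=
  fun i => a • quarterTurn (x i) + b

/-- The tangent space at `x` of the orbit of `x` under rotations and translations. -/
def orbitTangent (x : Configuration) : Submodule ℝ Configuration :=
  Submodule.span ℝ {v | ∃ (a : ℝ) (b : Plane), v = rigidVelocity a b x}

/-- The set `𝓔` of equilibria: the velocity on `M` vanishes at the class of `x`, that is, the
velocity at `x` is tangent to the orbit of `x`. -/
def equilibria (u : Feedback) (μ : Target) : Set Configuration :=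
  {x | ∃ (a : ℝ) (b : Plane), velocity u μ x = rigidVelocity a b x}

/-- The set `𝓔_s` of stable equilibria: the linearization on `M` at the class of `x` exists and all
its eigenvalues have negative real part. To linearize on `M`, subtract from the velocity the rigid
motion that it agrees with at `x` (this does not change the dynamics on `M`), differentiate at `x`,
and pass to the quotient of the tangent space by that of the orbit; the tangent space of the orbit is
invariant under `L` since the dynamics commutes with rigid motions. -/
def stableEquilibria (u : Feedback) (μ : Target) : Set Configuration :=
  {x | ∃ (a : ℝ) (b : Plane) (L : Configuration →L[ℝ] Configuration)
      (h : orbitTangent x ≤ (orbitTangent x).comap (L : Configuration →ₗ[ℝ] Configuration)),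
      velocity u μ x = rigidVelocity a b x ∧
      HasFDerivAt (fun y => velocity u μ y - rigidVelocity a b y) L x ∧
      ∀ c : ℂ, Polynomial.aeval c ((orbitTangent x).mapQ (orbitTangent x)
        (L : Configuration →ₗ[ℝ] Configuration) h).charpoly = 0 → c.re < 0}

/-- The set `𝓔_d` of design equilibria: the frameworks with the edge lengths of the target. -/
def designEquilibria (μ : Target) : Set Configuration :=
  {x | ‖z1 x‖ = d1 μ ∧ ‖z2 x‖ = d2 μ ∧ ‖z3 x‖ = d3 μ ∧ ‖z4 x‖ = d4 μ ∧ ‖z5 x‖ = d5 μ}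

/-- The set `𝓔_a = 𝓔 - 𝓔_d` of ancillary equilibria. -/
def ancillaryEquilibria (u : Feedback) (μ : Target) : Set Configuration :=
  equilibria u μ \ designEquilibria μ

/-- The feedback law `u` makes the 2-cycles formation type-A stable: for almost every target the
system has a stable equilibrium, and every stable equilibrium is a design equilibrium. -/
def TypeAStable (u : Feedback) : Prop :=
  ∀ᵐ μ : Target, (stableEquilibria u μ).Nonempty ∧ stableEquilibria u μ ⊆ designEquilibria μ

end

end TwoCycles

/-! Everything reduces to `not_dense_stablyRealized`: the targets with a stable design equilibrium
are not dense. Off their closure a stable equilibrium can only be ancillary, which is (2). Type-A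
stability holds on a dense set of targets, so it contradicts (2) at the law itself, which gives (1).

Assume density. At a generic framework the gain matrix is invertible, so all gains vanish at an
equilibrium (`gains_eq_zero`). Agent 1 knows `d1` and `d5` but not the target angle, so by density
`u11` and `u12` vanish whatever `z1ᵀz5` is (`leader_eq_zero`), and their derivatives in that
variable vanish too. In the half squared lengths the linearization is then `gainMatrix *
slopeMatrix`, a 5×5 matrix that must have negative determinant. Hence `gainDet` times the leader
Jacobian times the follower slopes is positive (`stable_sign`).

Up to isometry, a generic target has two design frameworks, related by reflecting agent 4 in the
line `x₁x₃`. With `z1` and `z5` at angles `α` and `γ` from `x₃ - x₁`, `gainDet` contains `sin (α -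
γ)` for one and `sin (α + γ)` for the other, whereas agent 1 sees only the cosines. Near `α = γ =
π/2` the first sine is close to a zero, and so is the second. Their signs can be chosen
independently without changing the cosines, and the remaining factors keep their signs. So the
determinant condition can be made to fail for both frameworks, on an open set of targets. -/

namespace TwoCycles

noncomputable section

/-! ### Plane geometry and the rigidity map -/

/-- The cross product of two plane vectors. -/
def cross (a b : Plane) : ℝ := a 0 * b 1 - a 1 * b 0

lemma inner_plane (a b : Plane) : inner ℝ a b = a 0 * b 0 + a 1 * b 1 := by
  simp [PiLp.inner_apply, Fin.sum_univ_two, mul_comm]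

lemma norm_sq_plane (a : Plane) : ‖a‖ ^ 2 = a 0 ^ 2 + a 1 ^ 2 := by
  rw [← real_inner_self_eq_norm_sq, inner_plane]; ring

/-- The velocities of the agents when the feedback gains have the values `c`. -/
def spread (x : Configuration) (c : Fin 5 → ℝ) : Configuration :=
  ![c 0 • z1 x + c 1 • z5 x, c 2 • z2 x, c 3 • z3 x, c 4 • z4 x]

/-- The values of the feedback gains at `x`. -/
def gains (u : Feedback) (μ : Target) (x : Configuration) : Fin 5 → ℝ :=
  ![u.u11.1 (δ1 μ, h1 x), u.u12.1 (δ1 μ, h1 x), u.u2.1 (δ2 μ, h2 x), u.u3.1 (δ3 μ, h3 x),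
    u.u4.1 (δ4 μ, h4 x)]

/-- The derivative of `(‖z₁‖², ‖z₅‖², ‖z₂‖², ‖z₃‖², ‖z₄‖²) / 2` at `x`. -/
def rigidity (x : Configuration) : Configuration →ₗ[ℝ] Fin 5 → ℝ where
  toFun v := ![inner ℝ (z1 x) (z1 v), inner ℝ (z5 x) (z5 v), inner ℝ (z2 x) (z2 v),
    inner ℝ (z3 x) (z3 v), inner ℝ (z4 x) (z4 v)]
  map_add' v w := by
    ext i
    fin_cases i <;> simp [inner_plane, z1, z2, z3, z4, z5] <;> ring
  map_smul' c v := by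
    ext i
    fin_cases i <;> simp [inner_plane, z1, z2, z3, z4, z5] <;> ring

/-- The matrix of the linear map from the gains to the velocities of the half squared lengths. -/
def gainMatrix (x : Configuration) : Matrix (Fin 5) (Fin 5) ℝ :=
  !![-inner ℝ (z1 x) (z1 x), -inner ℝ (z1 x) (z5 x), inner ℝ (z1 x) (z2 x), 0, 0;
     -inner ℝ (z5 x) (z1 x), -inner ℝ (z5 x) (z5 x), 0, 0, inner ℝ (z5 x) (z4 x);
     0, 0, -inner ℝ (z2 x) (z2 x), inner ℝ (z2 x) (z3 x), 0;
     inner ℝ (z3 x) (z1 x), inner ℝ (z3 x) (z5 x), 0, -inner ℝ (z3 x) (z3 x), 0;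
     0, 0, 0, inner ℝ (z4 x) (z3 x), -inner ℝ (z4 x) (z4 x)]

/-- Twice the signed area of the triangle `x₁, x₃, x₂`. -/
def area2 (x : Configuration) : ℝ := cross (x 2 - x 0) (z1 x)

/-- Twice the signed area of the triangle `x₁, x₃, x₄`. -/
def area4 (x : Configuration) : ℝ := cross (x 2 - x 0) (z5 x)

/-- The determinant of the gain matrix, up to sign. -/
def gainDet (x : Configuration) : ℝ :=
  area2 x * area4 x * cross (z1 x) (z5 x) * (area2 x * ‖z4 x‖ ^ 2 - area4 x * ‖z2 x‖ ^ 2)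

lemma velocity_eq_spread (u : Feedback) (μ : Target) (x : Configuration) :
    velocity u μ x = spread x (gains u μ x) := by
  simp [velocity, spread, gains, z1, z2, z3, z4, z5]

lemma rigidity_spread (x : Configuration) (c : Fin 5 → ℝ) :
    rigidity x (spread x c) = (gainMatrix x).mulVec c := by
  ext i
  fin_cases i <;>
  simp [rigidity, spread, gainMatrix, Matrix.mulVec, dotProduct, Fin.sum_univ_succ,
    -inner_self_eq_norm_sq_to_K] <;>
  simp only [z1, z2, z3, z4, z5, inner_plane] <;> simp <;> ring

lemma rigidity_rigidVelocity (x : Configuration) (a : ℝ) (b : Plane) :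
    rigidity x (rigidVelocity a b x) = 0 := by
  ext i
  fin_cases i <;>
  simp [rigidity, rigidVelocity, inner_plane, z1, z2, z3, z4, z5, quarterTurn] <;> ring

lemma det_gainMatrix (x : Configuration) : (gainMatrix x).det = -gainDet x := by
  simp only [gainMatrix, gainDet, area2, area4, cross, norm_sq_plane, inner_plane]
  simp [Matrix.det_succ_row_zero, Fin.sum_univ_succ, Fin.succAbove, z1, z2, z3, z4, z5]
  -- Coordinates relative to agent 1 leave a polynomial identity in six variables.
  obtain ⟨a, ha⟩ : ∃ a, a = x 1 0 - x 0 0 := ⟨_, rfl⟩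
  obtain ⟨b, hb⟩ : ∃ a, a = x 1 1 - x 0 1 := ⟨_, rfl⟩
  obtain ⟨c, hc⟩ : ∃ a, a = x 2 0 - x 0 0 := ⟨_, rfl⟩
  obtain ⟨d, hd⟩ : ∃ a, a = x 2 1 - x 0 1 := ⟨_, rfl⟩
  obtain ⟨e, he⟩ : ∃ a, a = x 3 0 - x 0 0 := ⟨_, rfl⟩
  obtain ⟨f, hf⟩ : ∃ a, a = x 3 1 - x 0 1 := ⟨_, rfl⟩
  rw [show x 1 0 = x 0 0 + a by linarith, show x 1 1 = x 0 1 + b by linarith,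
    show x 2 0 = x 0 0 + c by linarith, show x 2 1 = x 0 1 + d by linarith,
    show x 3 0 = x 0 0 + e by linarith, show x 3 1 = x 0 1 + f by linarith]
  simp only [add_sub_cancel_left, add_sub_add_left_eq_sub, sub_add_cancel_left]
  ring

lemma exists_inner_eq {a b : Plane} (h : cross a b ≠ 0) (s t : ℝ) :
    ∃ v : Plane, inner ℝ a v = s ∧ inner ℝ b v = t := by
  refine ⟨!₂[(s * b 1 - t * a 1) / cross a b, (t * a 0 - s * b 0) / cross a b], ?_, ?_⟩ <;>
  · rw [inner_plane]
    simp only [Matrix.cons_val_zero, Matrix.cons_val_one]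
    field_simp
    rw [cross]
    ring

lemma eq_of_inner_eq {a b v w : Plane} (h : cross a b ≠ 0) (ha : inner ℝ a v = inner ℝ a w)
    (hb : inner ℝ b v = inner ℝ b w) : v = w := by
  simp only [inner_plane] at ha hb
  ext i
  apply mul_left_cancel₀ h
  fin_cases i
  · simp only [cross, Fin.zero_eta]
    linear_combination b 1 * ha - a 1 * hb
  · simp only [cross, Fin.mk_one]
    linear_combination a 0 * hb - b 0 * ha

/-- Infinitesimal rigidity of two nondegenerate triangles glued along `x₁x₃`: the motion of this
edge fixes an angular velocity, and each remaining vertex is tied to both ends of the edge by two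
independent conditions. -/
lemma mem_orbitTangent_of_rigidity_eq_zero {x v : Configuration} (h2 : area2 x ≠ 0)
    (h4 : area4 x ≠ 0) (hv : rigidity x v = 0) : v ∈ orbitTangent x := by
  have e1 : inner ℝ (z1 x) (z1 v) = 0 := congrFun hv 0
  have e5 : inner ℝ (z5 x) (z5 v) = 0 := congrFun hv 1
  have e2 : inner ℝ (z2 x) (z2 v) = 0 := congrFun hv 2
  have e3 : inner ℝ (z3 x) (z3 v) = 0 := congrFun hv 3
  have e4 : inner ℝ (z4 x) (z4 v) = 0 := congrFun hv 4
  have hw : (x 2 - x 0) 0 ^ 2 + (x 2 - x 0) 1 ^ 2 ≠ 0 := by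
    intro h
    have h0 : (x 2 - x 0) 0 = 0 := by
      nlinarith [sq_nonneg ((x 2 - x 0) 0), sq_nonneg ((x 2 - x 0) 1)]
    have h1 : (x 2 - x 0) 1 = 0 := by
      nlinarith [sq_nonneg ((x 2 - x 0) 0), sq_nonneg ((x 2 - x 0) 1)]
    exact h2 (by rw [area2, cross, h0, h1]; ring)
  set w := x 2 - x 0 with hw_def
  -- The angular velocity of the edge `x₁x₃`.
  obtain ⟨a, ha⟩ : ∃ a : ℝ, a * (w 0 ^ 2 + w 1 ^ 2) = inner ℝ (quarterTurn w) (v 2 - v 0) :=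
    ⟨_, div_mul_cancel₀ _ hw⟩
  have hwv : v 2 - v 0 = a • quarterTurn w := by
    refine eq_of_inner_eq (a := w) (b := quarterTurn w) ?_ ?_ ?_
    · simpa [cross, quarterTurn, sq] using hw
    · have : inner ℝ w (v 2 - v 0) = 0 := by
        rw [← e3]; simp only [inner_plane, hw_def, z3]; simp; ring
      rw [this]
      simp [inner_plane, quarterTurn]; ring
    · rw [← ha]
      simp [inner_plane, quarterTurn]; ring
  have hv1 : v 1 - v 0 = a • quarterTurn (x 1 - x 0) := by
    have e1' : inner ℝ (z1 x) (v 1 - v 0) = inner ℝ (z1 x) (a • quarterTurn (x 1 - x 0)) := by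
      rw [← z1, e1]
      simp [inner_plane, quarterTurn, z1]; ring
    refine eq_of_inner_eq h2 ?_ e1'
    have k : v 1 - v 0 = a • quarterTurn w - z2 v := by rw [← hwv, z2]; abel
    have k2 : x 2 - x 0 = z1 x + z2 x := by rw [z1, z2]; abel
    rw [k2, inner_add_left, inner_add_left, e1', k, inner_sub_right, e2]
    simp [inner_plane, quarterTurn, z1, z2, hw_def]; ring
  have hv3 : v 3 - v 0 = a • quarterTurn (x 3 - x 0) := by
    have e1' : inner ℝ (z5 x) (v 3 - v 0) = inner ℝ (z5 x) (a • quarterTurn (x 3 - x 0)) := by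
      rw [← z5, e5]
      simp [inner_plane, quarterTurn, z5]; ring
    refine eq_of_inner_eq h4 ?_ e1'
    have k : v 3 - v 0 = a • quarterTurn w - z4 v := by rw [← hwv, z4]; abel
    have k2 : x 2 - x 0 = z5 x + z4 x := by rw [z5, z4]; abel
    rw [k2, inner_add_left, inner_add_left, e1', k, inner_sub_right, e4]
    simp [inner_plane, quarterTurn, z4, z5, hw_def]; ring
  refine Submodule.subset_span ⟨a, v 0 - a • quarterTurn (x 0), ?_⟩
  have key : ∀ i, v i - v 0 = a • quarterTurn (x i - x 0) →
      v i = a • quarterTurn (x i) + (v 0 - a • quarterTurn (x 0)) := by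
    intro i hi
    rw [sub_eq_iff_eq_add] at hi
    rw [hi]
    ext j
    fin_cases j <;> simp [quarterTurn] <;> ring
  funext i
  fin_cases i
  · simp [rigidVelocity]
  · exact key 1 hv1
  · exact key 2 hwv
  · exact key 3 hv3

/-- The five edge lengths vary independently. This lifts an eigenvector of the length dynamics to a
configuration velocity: fix `x₁`, solve for `x₃`, then for `x₂` and `x₄` separately. -/
lemma exists_rigidity_eq {x : Configuration} (h2 : area2 x ≠ 0) (h4 : area4 x ≠ 0)
    (t : Fin 5 → ℝ) : ∃ v, rigidity x v = t := by
  obtain ⟨v2, hv2, -⟩ := exists_inner_eq h2 (t 3) 0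
  obtain ⟨v1, hw1, hz1⟩ := exists_inner_eq h2 (t 0 + inner ℝ (z2 x) v2 - t 2) (t 0)
  obtain ⟨v3, hw3, hz3⟩ := exists_inner_eq h4 (t 1 + inner ℝ (z4 x) v2 - t 4) (t 1)
  refine ⟨![0, v1, v2, v3], ?_⟩
  have k1 : x 2 - x 0 = z1 x + z2 x := by rw [z1, z2]; abel
  have k3 : x 2 - x 0 = z5 x + z4 x := by rw [z5, z4]; abel
  have k2 : z3 x = -(x 2 - x 0) := by rw [z3]; abel
  rw [k1, inner_add_left] at hw1
  rw [k3, inner_add_left] at hw3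
  ext i
  fin_cases i
  · simpa [rigidity, z1] using hz1
  · simpa [rigidity, z5] using hz3
  · change inner ℝ (z2 x) (v2 - v1) = t 2
    rw [inner_sub_right]; linarith
  · change inner ℝ (z3 x) (0 - v2) = t 3
    rw [k2, zero_sub, inner_neg_neg, hv2]
  · change inner ℝ (z4 x) (v2 - v3) = t 4
    rw [inner_sub_right]; linarith

lemma rigidity_eq_zero_of_mem_orbitTangent {x v : Configuration} (hv : v ∈ orbitTangent x) :
    rigidity x v = 0 := by
  have : orbitTangent x ≤ LinearMap.ker (rigidity x) := by
    refine Submodule.span_le.2 ?_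
    rintro _ ⟨a, b, rfl⟩
    exact rigidity_rigidVelocity x a b
  exact this hv

/-! ### A real eigenvalue in the right half plane -/

/-- In odd dimension the characteristic polynomial takes the value `-det M ≤ 0` at `0` and tends to
`+∞`, so it has a root in `[0, ∞)`. -/
lemma exists_nonneg_eigenvector (M : Matrix (Fin 5) (Fin 5) ℝ) (hM : 0 ≤ M.det) :
    ∃ (l : ℝ) (w : Fin 5 → ℝ), 0 ≤ l ∧ w ≠ 0 ∧ M.mulVec w = l • w := by
  have hdeg : 0 < M.charpoly.degree := by
    rw [Matrix.charpoly_degree_eq_dim]; simp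
  have htop := M.charpoly.tendsto_atTop_of_leadingCoeff_nonneg hdeg
    (by rw [M.charpoly_monic.leadingCoeff]; norm_num)
  have h0 : M.charpoly.eval 0 ≤ 0 := by
    rw [Matrix.eval_charpoly]
    simp [Matrix.det_neg, Odd.neg_one_pow (show Odd 5 by decide), hM]
  obtain ⟨b, hb0, hb⟩ := ((htop.eventually_ge_atTop 0).and (Filter.eventually_ge_atTop 0)).exists
  obtain ⟨l, hl, hl0⟩ := intermediate_value_Icc hb M.charpoly.continuous.continuousOn ⟨h0, hb0⟩
  simp only [Matrix.eval_charpoly] at hl0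
  obtain ⟨w, hw, hw0⟩ := Matrix.exists_mulVec_eq_zero_iff.2 hl0
  refine ⟨l, w, hl.1, hw, ?_⟩
  rw [Matrix.sub_mulVec, sub_eq_zero] at hw0
  rw [← hw0]
  simp [Matrix.scalar_apply]

/-! ### The linearization at a design equilibrium -/

/-- The arguments of `u₁₁`, `u₁₂` at a design framework with `‖z₁‖ = a`, `‖z₅‖ = b`,
`z₁ᵀz₅ = s`. -/
def designPoint (p : ℝ × ℝ × ℝ) : (ℝ × ℝ) × (ℝ × ℝ × ℝ) := ((p.1, p.2.1), p)

/-- The derivatives of the gains at a design equilibrium with respect to the half squared lengths,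
provided that the gains of agent 1 are stationary in `z₁ᵀz₅`. -/
def slopeMatrix (u : Feedback) (x : Configuration) : Matrix (Fin 5) (Fin 5) ℝ :=
  !![fderiv ℝ u.u11.1 (designPoint (h1 x)) (0, 1, 0, 0) / ‖z1 x‖,
      fderiv ℝ u.u11.1 (designPoint (h1 x)) (0, 0, 1, 0) / ‖z5 x‖, 0, 0, 0;
     fderiv ℝ u.u12.1 (designPoint (h1 x)) (0, 1, 0, 0) / ‖z1 x‖,
      fderiv ℝ u.u12.1 (designPoint (h1 x)) (0, 0, 1, 0) / ‖z5 x‖, 0, 0, 0;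
     0, 0, fderiv ℝ u.u2.1 (‖z2 x‖, ‖z2 x‖) (0, 1) / ‖z2 x‖, 0, 0;
     0, 0, 0, fderiv ℝ u.u3.1 (‖z3 x‖, ‖z3 x‖) (0, 1) / ‖z3 x‖, 0;
     0, 0, 0, 0, fderiv ℝ u.u4.1 (‖z4 x‖, ‖z4 x‖) (0, 1) / ‖z4 x‖]

/-- The Jacobian determinant of `(u₁₁, u₁₂)` in `(‖z₁‖, ‖z₅‖)` at a design point. -/
def leaderJacobian (u : Feedback) (p : ℝ × ℝ × ℝ) : ℝ :=
  fderiv ℝ u.u11.1 (designPoint p) (0, 1, 0, 0) * fderiv ℝ u.u12.1 (designPoint p) (0, 0, 1, 0) -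
  fderiv ℝ u.u11.1 (designPoint p) (0, 0, 1, 0) * fderiv ℝ u.u12.1 (designPoint p) (0, 1, 0, 0)

/-- The product of the slopes of `u₂`, `u₃`, `u₄` at the design lengths. -/
def followerSlope (u : Feedback) (a b c : ℝ) : ℝ :=
  fderiv ℝ u.u2.1 (a, a) (0, 1) * fderiv ℝ u.u3.1 (b, b) (0, 1) * fderiv ℝ u.u4.1 (c, c) (0, 1)

lemma det_slopeMatrix (u : Feedback) (x : Configuration) :
    (slopeMatrix u x).det = leaderJacobian u (h1 x) * followerSlope u ‖z2 x‖ ‖z3 x‖ ‖z4 x‖ /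
      (‖z1 x‖ * ‖z5 x‖ * ‖z2 x‖ * ‖z3 x‖ * ‖z4 x‖) := by
  simp [slopeMatrix, leaderJacobian, followerSlope, Matrix.det_succ_row_zero, Fin.sum_univ_succ,
    Fin.succAbove]
  ring

lemma hasDerivAt_norm_add_smul {z : Plane} (hz : z ≠ 0) (w : Plane) :
    HasDerivAt (fun t : ℝ => ‖z + t • w‖) (inner ℝ z w / ‖z‖) 0 := by
  have h : HasDerivAt (fun t : ℝ => z + t • w) w 0 := by
    simpa using ((hasDerivAt_id (0 : ℝ)).smul_const w).const_add z
  have h2 := h.norm_sq.sqrt (by simpa using hz)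
  simp only [Real.sqrt_sq (norm_nonneg _), zero_smul, add_zero] at h2
  convert h2 using 1
  ring

lemma hasDerivAt_inner_add_smul (z w z' w' : Plane) :
    HasDerivAt (fun t : ℝ => inner ℝ (z + t • w) (z' + t • w')) (inner ℝ z w' + inner ℝ w z') 0 := by
  have h (z w : Plane) : HasDerivAt (fun t : ℝ => z + t • w) w 0 := by
    simpa using ((hasDerivAt_id (0 : ℝ)).smul_const w).const_add z
  simpa using (h z w).inner ℝ (h z' w')

lemma SmoothFn.hasFDerivAt {E : Type} [NormedAddCommGroup E] [NormedSpace ℝ E] (f : SmoothFn E)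
    (p : E) : HasFDerivAt f.1 (fderiv ℝ f.1 p) p :=
  (f.2.differentiable (by simp) p).hasFDerivAt

lemma hasDerivAt_follower (f : SmoothFn (ℝ × ℝ)) {d : ℝ} {z : Plane} (hd : ‖z‖ = d) (hz : z ≠ 0)
    (w : Plane) : HasDerivAt (fun t : ℝ => f.1 (d, ‖z + t • w‖))
      (fderiv ℝ f.1 (‖z‖, ‖z‖) (0, 1) / ‖z‖ * inner ℝ z w) 0 := by
  have h := (hasDerivAt_const (0 : ℝ) d).prodMk (hasDerivAt_norm_add_smul hz w)
  have hf := f.hasFDerivAt (d, ‖z + (0 : ℝ) • w‖)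
  have h3 := hf.comp_hasDerivAt (0 : ℝ) h
  refine h3.congr_deriv ?_
  rw [zero_smul, add_zero, hd,
    show ((0 : ℝ), inner ℝ z w / d) = (inner ℝ z w / d) • ((0 : ℝ), (1 : ℝ)) by simp, map_smul,
    smul_eq_mul]
  ring

/-- With `hf` the term in `zᵀz'` drops out, so the derivative depends only on the changes of the two
lengths. This makes the leader block of `slopeMatrix` 2×2. -/
lemma hasDerivAt_leader (f : SmoothFn ((ℝ × ℝ) × (ℝ × ℝ × ℝ))) {a b : ℝ} {z z' : Plane}
    (ha : ‖z‖ = a) (hb : ‖z'‖ = b) (hz : z ≠ 0) (hz' : z' ≠ 0) (w w' : Plane)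
    (hf : fderiv ℝ f.1 (designPoint (a, b, inner ℝ z z')) (0, 0, 0, 1) = 0) :
    HasDerivAt (fun t : ℝ => f.1 ((a, b), (‖z + t • w‖, ‖z' + t • w'‖,
        inner ℝ (z + t • w) (z' + t • w'))))
      (fderiv ℝ f.1 (designPoint (a, b, inner ℝ z z')) (0, 1, 0, 0) / ‖z‖ * inner ℝ z w +
        fderiv ℝ f.1 (designPoint (a, b, inner ℝ z z')) (0, 0, 1, 0) / ‖z'‖ * inner ℝ z' w') 0 := by
  have h := (hasDerivAt_const (0 : ℝ) (a, b)).prodMk ((hasDerivAt_norm_add_smul hz w).prodMk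
    ((hasDerivAt_norm_add_smul hz' w').prodMk (hasDerivAt_inner_add_smul z w z' w')))
  have hf' := f.hasFDerivAt ((a, b), (‖z + (0 : ℝ) • w‖, ‖z' + (0 : ℝ) • w'‖,
    inner ℝ (z + (0 : ℝ) • w) (z' + (0 : ℝ) • w')))
  have h3 := hf'.comp_hasDerivAt (0 : ℝ) h
  refine h3.congr_deriv ?_
  simp only [zero_smul, add_zero, ha, hb]
  change fderiv ℝ f.1 (designPoint (a, b, inner ℝ z z')) _ = _
  generalize fderiv ℝ f.1 (designPoint (a, b, inner ℝ z z')) = D at *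
  have hv (p q s : ℝ) : ((0 : ℝ × ℝ), (p, q, s)) = p • ((0 : ℝ × ℝ), ((1 : ℝ), (0 : ℝ), (0 : ℝ))) +
    q • ((0 : ℝ × ℝ), ((0 : ℝ), (1 : ℝ), (0 : ℝ))) +
    s • ((0 : ℝ × ℝ), ((0 : ℝ), (0 : ℝ), (1 : ℝ))) := by simp
  rw [hv, map_add, map_add, map_smul, map_smul, map_smul, hf]
  simp only [smul_eq_mul]
  ring

lemma z_add_smul (x v : Configuration) (t : ℝ) :
    z1 (x + t • v) = z1 x + t • z1 v ∧ z2 (x + t • v) = z2 x + t • z2 v ∧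
    z3 (x + t • v) = z3 x + t • z3 v ∧ z4 (x + t • v) = z4 x + t • z4 v ∧
    z5 (x + t • v) = z5 x + t • z5 v := by
  refine ⟨?_, ?_, ?_, ?_, ?_⟩ <;> simp [z1, z2, z3, z4, z5] <;> module

lemma ne_zero_of_gainDet_ne_zero {x : Configuration} (h : gainDet x ≠ 0) :
    area2 x ≠ 0 ∧ area4 x ≠ 0 ∧ z1 x ≠ 0 ∧ z2 x ≠ 0 ∧ z3 x ≠ 0 ∧ z4 x ≠ 0 ∧ z5 x ≠ 0 := by
  have h2 : area2 x ≠ 0 := fun h0 => h (by simp [gainDet, h0])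
  have h4 : area4 x ≠ 0 := fun h0 => h (by simp [gainDet, h0])
  refine ⟨h2, h4, fun h0 => h2 ?_, fun h0 => h2 ?_, fun h0 => h2 ?_, fun h0 => h4 ?_,
    fun h0 => h4 ?_⟩
  · simp [area2, cross, h0]
  · rw [area2, show x 2 - x 0 = z1 x + z2 x by rw [z1, z2]; abel, h0]
    simp [cross]; ring
  · rw [area2, show x 2 - x 0 = -z3 x by rw [z3]; abel, h0]
    simp [cross]
  · rw [area4, show x 2 - x 0 = z5 x + z4 x by rw [z5, z4]; abel, h0]
    simp [cross]; ring
  · simp [area4, cross, h0]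

lemma hasDerivAt_gains {u : Feedback} {μ : Target} {x : Configuration}
    (hx : x ∈ designEquilibria μ) (hG : gainDet x ≠ 0)
    (h11 : fderiv ℝ u.u11.1 (designPoint (h1 x)) (0, 0, 0, 1) = 0)
    (h12 : fderiv ℝ u.u12.1 (designPoint (h1 x)) (0, 0, 0, 1) = 0) (v : Configuration) :
    HasDerivAt (fun t : ℝ => gains u μ (x + t • v))
      ((slopeMatrix u x).mulVec (rigidity x v)) 0 := by
  obtain ⟨-, -, n1, n2, n3, n4, n5⟩ := ne_zero_of_gainDet_ne_zero hG
  obtain ⟨d1, d2, d3, d4, d5⟩ := hx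
  rw [hasDerivAt_pi]
  have l (f : SmoothFn ((ℝ × ℝ) × (ℝ × ℝ × ℝ)))
      (hf : fderiv ℝ f.1 (designPoint (h1 x)) (0, 0, 0, 1) = 0) :=
    hasDerivAt_leader f rfl rfl n1 n5 (z1 v) (z5 v) hf
  intro i
  fin_cases i
  · refine ((l u.u11 h11).congr_deriv ?_).congr_of_eventuallyEq
      (.of_forall fun t => ?_)
    · simp [slopeMatrix, Matrix.mulVec, dotProduct, Fin.sum_univ_succ, rigidity, h1]
    · simp [gains, δ1, h1, z_add_smul, d1, d5]
  · refine ((l u.u12 h12).congr_deriv ?_).congr_of_eventuallyEq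
      (.of_forall fun t => ?_)
    · simp [slopeMatrix, Matrix.mulVec, dotProduct, Fin.sum_univ_succ, rigidity, h1]
    · simp [gains, δ1, h1, z_add_smul, d1, d5]
  · refine ((hasDerivAt_follower u.u2 d2 n2 (z2 v)).congr_deriv ?_).congr_of_eventuallyEq
      (.of_forall fun t => ?_)
    · simp [slopeMatrix, Matrix.mulVec, dotProduct, Fin.sum_univ_succ, rigidity]
    · simp [gains, δ2, h2, z_add_smul]
  · refine ((hasDerivAt_follower u.u3 d3 n3 (z3 v)).congr_deriv ?_).congr_of_eventuallyEq
      (.of_forall fun t => ?_)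
    · simp [slopeMatrix, Matrix.mulVec, dotProduct, Fin.sum_univ_succ, rigidity]
    · simp [gains, δ3, h3, z_add_smul]
  · refine ((hasDerivAt_follower u.u4 d4 n4 (z4 v)).congr_deriv ?_).congr_of_eventuallyEq
      (.of_forall fun t => ?_)
    · simp [slopeMatrix, Matrix.mulVec, dotProduct, Fin.sum_univ_succ, rigidity]
    · simp [gains, δ4, h4, z_add_smul]

/-- By the product rule only the derivatives of the gains survive, since the gains themselves vanish
at `x`. -/
lemma hasDerivAt_velocity {u : Feedback} {μ : Target} {x v : Configuration} {c' : Fin 5 → ℝ}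
    (h0 : gains u μ x = 0) (h : HasDerivAt (fun t : ℝ => gains u μ (x + t • v)) c' 0) :
    HasDerivAt (fun t : ℝ => velocity u μ (x + t • v)) (spread x c') 0 := by
  have hz (z w : Plane) : HasDerivAt (fun t : ℝ => z + t • w) w 0 := by
    simpa using ((hasDerivAt_id (0 : ℝ)).smul_const w).const_add z
  have hg (i : Fin 5) (z w : Plane) :
      HasDerivAt (fun t : ℝ => gains u μ (x + t • v) i • (z + t • w)) (c' i • z) 0 := by
    exact (((hasDerivAt_pi.1 h) i).smul (hz z w)).congr_deriv (by simp [h0])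
  rw [hasDerivAt_pi]
  simp only [velocity_eq_spread]
  intro i
  fin_cases i
  · refine ((hg 0 (z1 x) (z1 v)).add (hg 1 (z5 x) (z5 v))).congr_of_eventuallyEq
      (.of_forall fun t => ?_)
    simp [spread, z_add_smul]
  · exact (hg 2 (z2 x) (z2 v)).congr_of_eventuallyEq
      (.of_forall fun t => by simp [spread, z_add_smul])
  · exact (hg 3 (z3 x) (z3 v)).congr_of_eventuallyEq
      (.of_forall fun t => by simp [spread, z_add_smul])
  · exact (hg 4 (z4 x) (z4 v)).congr_of_eventuallyEq
      (.of_forall fun t => by simp [spread, z_add_smul])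

/-- A rigid motion preserves lengths, so the gain vector lies in the kernel of the gain matrix,
which is trivial. -/
lemma gains_eq_zero {u : Feedback} {μ : Target} {x : Configuration} (hG : gainDet x ≠ 0)
    {a : ℝ} {b : Plane} (h : velocity u μ x = rigidVelocity a b x) : gains u μ x = 0 := by
  have h1 := rigidity_rigidVelocity x a b
  rw [← h, velocity_eq_spread, rigidity_spread] at h1
  refine Matrix.eq_zero_of_mulVec_eq_zero ?_ h1
  rwa [det_gainMatrix, neg_ne_zero]

lemma rigidVelocity_eq_zero {x : Configuration} (hz : z1 x ≠ 0) {a : ℝ} {b : Plane}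
    (h : rigidVelocity a b x = 0) : a = 0 ∧ b = 0 := by
  have k0 := congrFun h 0
  have k1 := congrFun h 1
  simp only [rigidVelocity, Pi.zero_apply] at k0 k1
  have ha : a = 0 := by
    by_contra ha
    refine hz ?_
    have k : a • (quarterTurn (x 1) - quarterTurn (x 0)) = 0 := by
      rw [smul_sub, sub_eq_zero]; exact add_right_cancel (k1.trans k0.symm)
    have k := (smul_eq_zero.1 k).resolve_left ha
    have e0 := congrFun (congrArg WithLp.ofLp k) 0
    have e1 := congrFun (congrArg WithLp.ofLp k) 1
    simp [quarterTurn] at e0 e1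
    ext i
    fin_cases i
    · simpa [z1] using e1
    · simp [z1]; linarith
  subst ha
  exact ⟨rfl, by simpa using k0⟩

/-- At a stable design equilibrium the linearized length dynamics has negative determinant. -/
lemma gainDet_mul_pos {u : Feedback} {μ : Target} {x : Configuration}
    (hs : x ∈ stableEquilibria u μ) (hx : x ∈ designEquilibria μ) (hG : gainDet x ≠ 0)
    (h11 : fderiv ℝ u.u11.1 (designPoint (h1 x)) (0, 0, 0, 1) = 0)
    (h12 : fderiv ℝ u.u12.1 (designPoint (h1 x)) (0, 0, 0, 1) = 0) :
    0 < gainDet x * (leaderJacobian u (h1 x) * followerSlope u ‖z2 x‖ ‖z3 x‖ ‖z4 x‖) := by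
  obtain ⟨a, b, L, hL, hv, hd, hc⟩ := hs
  obtain ⟨m2, m4, n1, n2, n3, n4, n5⟩ := ne_zero_of_gainDet_ne_zero hG
  have hg := gains_eq_zero hG hv
  have hr : rigidVelocity a b x = 0 := by
    rw [← hv, velocity_eq_spread, hg]
    funext i; fin_cases i <;> simp [spread]
  -- The subtracted rigid motion is zero, so `L` is the derivative of the velocity itself. Its
  -- action on lengths can be computed along lines.
  obtain ⟨rfl, rfl⟩ := rigidVelocity_eq_zero n1 hr
  have hLv (v : Configuration) :
      rigidity x (L v) = (gainMatrix x * slopeMatrix u x).mulVec (rigidity x v) := by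
    have e1 := hasDerivAt_velocity hg (hasDerivAt_gains hx hG h11 h12 v)
    have e2 : HasDerivAt (fun t : ℝ => velocity u μ (x + t • v)) (L v) 0 := by
      have hl : HasDerivAt (fun t : ℝ => x + t • v) v 0 := by
        simpa using ((hasDerivAt_id (0 : ℝ)).smul_const v).const_add x
      have hd' : HasFDerivAt (fun y => velocity u μ y) L (x + (0 : ℝ) • v) := by
        have h0 (y : Configuration) : rigidVelocity 0 0 y = 0 := by
          funext i; simp [rigidVelocity]
        simpa [h0] using hd
      exact hd'.comp_hasDerivAt (0 : ℝ) hl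
    rw [e2.unique e1, rigidity_spread, Matrix.mulVec_mulVec]
  by_contra hneg
  have hdet : 0 ≤ (gainMatrix x * slopeMatrix u x).det := by
    rw [Matrix.det_mul, det_gainMatrix, det_slopeMatrix, neg_mul, ← mul_div_assoc, ← neg_div]
    exact div_nonneg (by linarith) (by positivity)
  obtain ⟨l, w, hl, hw, hlw⟩ := exists_nonneg_eigenvector _ hdet
  obtain ⟨v, rfl⟩ := exists_rigidity_eq m2 m4 w
  -- Modulo the orbit, `v` becomes an eigenvector for `l ≥ 0`, against stability.
  have hker : L v - l • v ∈ orbitTangent x := by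
    refine mem_orbitTangent_of_rigidity_eq_zero m2 m4 ?_
    rw [map_sub, map_smul, hLv, hlw, sub_self]
  have hev : Module.End.HasEigenvector ((orbitTangent x).mapQ (orbitTangent x)
      (L : Configuration →ₗ[ℝ] Configuration) hL) l (Submodule.Quotient.mk v) := by
    refine ⟨Module.End.mem_eigenspace_iff.2 ?_, fun h0 => hw ?_⟩
    · rw [← Submodule.mkQ_apply, Submodule.mkQ_apply, Submodule.mapQ_apply,
        ← Submodule.Quotient.mk_smul, Submodule.Quotient.eq]
      exact hker
    · exact rigidity_eq_zero_of_mem_orbitTangent ((Submodule.Quotient.mk_eq_zero _).1 h0)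
  have hroot := (Module.End.hasEigenvalue_iff_isRoot_charpoly _ _).1
    (Module.End.hasEigenvalue_of_hasEigenvector hev)
  have := hc (l : ℂ) (by
    rw [← Complex.coe_algebraMap, Polynomial.aeval_algebraMap_apply, Polynomial.aeval_def,
      Algebra.algebraMap_self, Polynomial.eval₂_id, hroot.eq_zero, map_zero])
  simp at this
  linarith

/-! ### The frameworks with given edge lengths -/

/-- The value of `‖z₃‖² * gainDet` after reflecting agent 4 in the line `x₁x₃` if `τ = -1`. -/
def flipDet (τ : ℝ) (x : Configuration) : ℝ :=
  area2 x * (τ * area4 x) *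
    (inner ℝ (x 2 - x 0) (z1 x) * (τ * area4 x) - inner ℝ (x 2 - x 0) (z5 x) * area2 x) *
    (area2 x * ‖z4 x‖ ^ 2 - τ * area4 x * ‖z2 x‖ ^ 2)

/-- The value of `z₁ᵀz₅` after reflecting agent 4 in the line `x₁x₃` if `τ = -1`. -/
def flipInner (τ : ℝ) (x : Configuration) : ℝ :=
  (inner ℝ (x 2 - x 0) (z1 x) * inner ℝ (x 2 - x 0) (z5 x) + area2 x * (τ * area4 x)) / ‖z3 x‖ ^ 2

lemma inner_eq_of_sides (x : Configuration) :
    inner ℝ (x 2 - x 0) (z1 x) = (‖z3 x‖ ^ 2 + ‖z1 x‖ ^ 2 - ‖z2 x‖ ^ 2) / 2 ∧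
    inner ℝ (x 2 - x 0) (z5 x) = (‖z3 x‖ ^ 2 + ‖z5 x‖ ^ 2 - ‖z4 x‖ ^ 2) / 2 := by
  constructor <;> simp [inner_plane, norm_sq_plane, z1, z2, z3, z4, z5] <;> ring

lemma area_sq (x : Configuration) :
    area2 x ^ 2 = ‖z3 x‖ ^ 2 * ‖z1 x‖ ^ 2 - inner ℝ (x 2 - x 0) (z1 x) ^ 2 ∧
    area4 x ^ 2 = ‖z3 x‖ ^ 2 * ‖z5 x‖ ^ 2 - inner ℝ (x 2 - x 0) (z5 x) ^ 2 := by
  constructor <;>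
  simp [area2, area4, cross, inner_plane, norm_sq_plane, z1, z3, z5] <;> ring

lemma norm_sq_mul_cross (x : Configuration) : ‖z3 x‖ ^ 2 * cross (z1 x) (z5 x) =
    inner ℝ (x 2 - x 0) (z1 x) * area4 x - inner ℝ (x 2 - x 0) (z5 x) * area2 x := by
  simp [area2, area4, cross, inner_plane, norm_sq_plane, z1, z3, z5]; ring

lemma norm_sq_mul_inner (x : Configuration) : ‖z3 x‖ ^ 2 * inner ℝ (z1 x) (z5 x) =
    inner ℝ (x 2 - x 0) (z1 x) * inner ℝ (x 2 - x 0) (z5 x) + area2 x * area4 x := by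
  simp [area2, area4, cross, inner_plane, norm_sq_plane, z1, z3, z5]; ring

/-- The side lengths determine each triangle's area up to sign. Only the product of the two signed
areas matters for `gainDet` and `z1ᵀz5`, so a single sign `τ` remains. -/
lemma exists_flip {μ : Target} {x : Configuration} (hx : x ∈ designEquilibria μ) :
    ∃ τ : ℝ, (τ = 1 ∨ τ = -1) ∧ ‖z3 x‖ ^ 2 * gainDet x = flipDet τ μ.framework ∧
      (z3 x ≠ 0 → inner ℝ (z1 x) (z5 x) = flipInner τ μ.framework) := by
  obtain ⟨e1, e2, e3, e4, e5⟩ := hx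
  simp only [d1, d2, d3, d4, d5] at e1 e2 e3 e4 e5
  generalize μ.framework = y at *
  obtain ⟨m2, m4⟩ := inner_eq_of_sides x
  obtain ⟨m2', m4'⟩ := inner_eq_of_sides y
  rw [e1, e2, e3, ← m2'] at m2
  rw [e3, e4, e5, ← m4'] at m4
  obtain ⟨a2, a4⟩ := area_sq x
  obtain ⟨a2', a4'⟩ := area_sq y
  rw [e1, e3, m2, ← a2'] at a2
  rw [e5, e3, m4, ← a4'] at a4
  have hc := norm_sq_mul_cross x
  have hi := norm_sq_mul_inner x
  rw [m2, m4] at hc hi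
  obtain ⟨τ, hτ, hq⟩ : ∃ τ : ℝ, (τ = 1 ∨ τ = -1) ∧
      area2 x * area4 x = τ * (area2 y * area4 y) := by
    have : (area2 x * area4 x) ^ 2 = (area2 y * area4 y) ^ 2 := by rw [mul_pow, mul_pow, a2, a4]
    rcases sq_eq_sq_iff_eq_or_eq_neg.1 this with h | h
    · exact ⟨1, .inl rfl, by rw [h, one_mul]⟩
    · exact ⟨-1, .inr rfl, by rw [h]; ring⟩
  have hτ2 : τ ^ 2 = 1 := by rcases hτ with rfl | rfl <;> norm_num
  refine ⟨τ, hτ, ?_, fun h3 => ?_⟩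
  · have : ‖z3 x‖ ^ 2 * gainDet x = (area2 x * area4 x) * (‖z3 x‖ ^ 2 * cross (z1 x) (z5 x)) *
        (area2 x * ‖z4 x‖ ^ 2 - area4 x * ‖z2 x‖ ^ 2) := by rw [gainDet]; ring
    rw [this, hc, e4, e2, flipDet]
    generalize inner ℝ (y 2 - y 0) (z1 y) = p at *
    generalize inner ℝ (y 2 - y 0) (z5 y) = q at *
    generalize ‖z4 y‖ ^ 2 = P at *
    generalize ‖z2 y‖ ^ 2 = Q at *
    -- The right side involves the signed areas only through `A * B`, `A ^ 2` and `B ^ 2`.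
    have k (A B : ℝ) : (A * B) * (p * B - q * A) * (A * P - B * Q) =
      (A * B) * ((p * P + q * Q) * (A * B) - p * B ^ 2 * Q - q * A ^ 2 * P) := by ring
    rw [k, hq, a2, a4, show τ * (area2 y * area4 y) = area2 y * (τ * area4 y) by ring,
      mul_assoc τ, ← mul_assoc τ, k, mul_pow, hτ2, one_mul]
  · rw [flipInner, ← e3, eq_div_iff (by simpa using h3), mul_comm, hi, hq]
    ring

lemma continuous_z : Continuous z1 ∧ Continuous z2 ∧ Continuous z3 ∧ Continuous z4 ∧
    Continuous z5 := by
  have h (i j : Fin 4) : Continuous fun x : Configuration => x i - x j := by fun_prop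
  exact ⟨h 1 0, h 2 1, h 0 2, h 2 3, h 3 0⟩

lemma continuous_cross {X : Type*} [TopologicalSpace X] {f g : X → Plane} (hf : Continuous f)
    (hg : Continuous g) : Continuous fun x => cross (f x) (g x) := by
  unfold cross; fun_prop

lemma continuous_flipDet (τ : ℝ) : Continuous (flipDet τ) := by
  obtain ⟨c1, c2, c3, c4, c5⟩ := continuous_z
  have k2 : Continuous area2 := continuous_cross (by fun_prop) c1
  have k4 : Continuous area4 := continuous_cross (by fun_prop) c5
  unfold flipDet; fun_prop

lemma continuousAt_flipInner (τ : ℝ) {x : Configuration} (hx : z3 x ≠ 0) :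
    ContinuousAt (flipInner τ) x := by
  obtain ⟨c1, c2, c3, c4, c5⟩ := continuous_z
  have k2 : Continuous area2 := continuous_cross (by fun_prop) c1
  have k4 : Continuous area4 := continuous_cross (by fun_prop) c5
  unfold flipInner
  refine ContinuousAt.div (by fun_prop) (by fun_prop) (by simpa using hx)

lemma continuous_framework : Continuous Target.framework := by
  refine continuous_pi fun i => ?_
  fin_cases i <;> simp [Target.framework] <;> fun_prop

lemma z3_ne_zero_of_flipDet {τ : ℝ} {x : Configuration} (h : flipDet τ x ≠ 0) : z3 x ≠ 0 := by
  intro h0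
  apply h
  have : area2 x = 0 := by
    rw [area2, show x 2 - x 0 = -z3 x by rw [z3]; abel, h0]
    simp [cross]
  simp [flipDet, this]

/-- What agent 1 sees at the target or, if `τ = -1`, at its flip. -/
def flipH1 (τ : ℝ) (μ : Target) : ℝ × ℝ × ℝ := (d1 μ, d5 μ, flipInner τ μ.framework)

lemma continuous_lengths : Continuous d1 ∧ Continuous d2 ∧ Continuous d3 ∧ Continuous d4 ∧
    Continuous d5 := by
  obtain ⟨c1, c2, c3, c4, c5⟩ := continuous_z
  have := continuous_framework
  exact ⟨(c1.comp this).norm, (c2.comp this).norm, (c3.comp this).norm, (c4.comp this).norm,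
    (c5.comp this).norm⟩

lemma continuousAt_flipH1 (τ : ℝ) {μ : Target} (h : z3 μ.framework ≠ 0) :
    ContinuousAt (flipH1 τ) μ := by
  obtain ⟨c1, c2, c3, c4, c5⟩ := continuous_lengths
  exact c1.continuousAt.prodMk (c5.continuousAt.prodMk
    ((continuousAt_flipInner τ h).comp continuous_framework.continuousAt))

/-! ### Density of targets with a stable design equilibrium -/

/-- The targets which have a stable design equilibrium. -/
def stablyRealized (u : Feedback) : Set Target :=
  {μ | (stableEquilibria u μ ∩ designEquilibria μ).Nonempty}

/-- Density does not reveal which of the two flips is stable. Nondegeneracy is therefore required of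
both, and the sign `τ` is returned. -/
lemma exists_stable_near {u : Feedback} (H : Dense (stablyRealized u)) {μ₀ : Target}
    (hp : flipDet 1 μ₀.framework ≠ 0) (hm : flipDet (-1) μ₀.framework ≠ 0) {P : Target → Prop}
    (hP : ∀ᶠ μ in 𝓝 μ₀, P μ) :
    ∃ μ x τ, P μ ∧ x ∈ stableEquilibria u μ ∧ x ∈ designEquilibria μ ∧ gainDet x ≠ 0 ∧
      (τ = 1 ∨ τ = -1) ∧ ‖z3 x‖ ^ 2 * gainDet x = flipDet τ μ.framework ∧ h1 x = flipH1 τ μ := by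
  have hc (τ : ℝ) (h : flipDet τ μ₀.framework ≠ 0) :
      ∀ᶠ μ in 𝓝 μ₀, flipDet τ μ.framework ≠ 0 :=
    ((continuous_flipDet τ).comp continuous_framework).continuousAt.eventually_ne h
  obtain ⟨μ, ⟨x, hs, hx⟩, hPμ, hpμ, hmμ⟩ :=
    ((mem_closure_iff_frequently.1 (H μ₀)).and_eventually (hP.and ((hc 1 hp).and (hc _ hm)))).exists
  obtain ⟨τ, hτ, hdet, hin⟩ := exists_flip hx
  have hG : gainDet x ≠ 0 := by
    intro h0
    rw [h0, mul_zero] at hdet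
    rcases hτ with rfl | rfl
    · exact hpμ hdet.symm
    · exact hmμ hdet.symm
  refine ⟨μ, x, τ, hPμ, hs, hx, hG, hτ, hdet, ?_⟩
  rw [h1, flipH1, ← hin (ne_zero_of_gainDet_ne_zero hG).2.2.2.2.1, hx.1, hx.2.2.2.2]

/-- The target with `x̄₃ = (r, 0)` and with `x̄₂`, `x̄₄` given in polar coordinates. -/
def polarTarget (r a b α γ : ℝ) : Target :=
  ![!₂[a * Real.cos α, a * Real.sin α], !₂[r, 0], !₂[b * Real.cos γ, b * Real.sin γ]]

lemma polarTarget_lengths (r a b α γ : ℝ) :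
    d1 (polarTarget r a b α γ) ^ 2 = a ^ 2 ∧
    d2 (polarTarget r a b α γ) ^ 2 = r ^ 2 + a ^ 2 - 2 * r * a * Real.cos α ∧
    d3 (polarTarget r a b α γ) ^ 2 = r ^ 2 ∧
    d4 (polarTarget r a b α γ) ^ 2 = r ^ 2 + b ^ 2 - 2 * r * b * Real.cos γ ∧
    d5 (polarTarget r a b α γ) ^ 2 = b ^ 2 := by
  have h1 := Real.sin_sq_add_cos_sq α
  have h2 := Real.sin_sq_add_cos_sq γ
  simp only [d1, d2, d3, d4, d5, norm_sq_plane]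
  simp [z1, z2, z3, z4, z5, Target.framework, polarTarget]
  refine ⟨?_, ?_, ?_, ?_⟩
  · linear_combination a ^ 2 * h1
  · linear_combination a ^ 2 * h1
  · linear_combination b ^ 2 * h2
  · linear_combination b ^ 2 * h2

lemma flipDet_polarTarget {τ : ℝ} (hτ : τ = 1 ∨ τ = -1) (r a b α γ : ℝ) :
    flipDet τ (polarTarget r a b α γ).framework =
      -(τ * r ^ 5 * a ^ 2 * b ^ 2 * (Real.sin α * Real.sin γ)) * Real.sin (α - τ * γ) *
      (a * Real.sin α * (r ^ 2 + b ^ 2 - 2 * r * b * Real.cos γ) -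
        τ * b * Real.sin γ * (r ^ 2 + a ^ 2 - 2 * r * a * Real.cos α)) := by
  obtain ⟨-, e2, -, e4, -⟩ := polarTarget_lengths r a b α γ
  rw [flipDet, ← d2, ← d4, e2, e4]
  simp [area2, area4, cross, inner_plane, z1, z5, Target.framework, polarTarget]
  rcases hτ with rfl | rfl
  · simp only [one_mul, Real.sin_sub]; ring
  · rw [show α - -1 * γ = α + γ by ring, Real.sin_add]; ring

lemma flipInner_polarTarget {τ : ℝ} (hτ : τ = 1 ∨ τ = -1) {r : ℝ} (hr : r ≠ 0) (a b α γ : ℝ) :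
    flipInner τ (polarTarget r a b α γ).framework = a * b * Real.cos (α - τ * γ) := by
  obtain ⟨-, -, e3, -, -⟩ := polarTarget_lengths r a b α γ
  rw [flipInner, ← d3, e3, div_eq_iff (by positivity)]
  simp [area2, area4, cross, inner_plane, z1, z5, Target.framework, polarTarget]
  rcases hτ with rfl | rfl
  · simp only [one_mul, Real.cos_sub]; ring
  · rw [show α - -1 * γ = α + γ by ring, Real.cos_add]; ring

lemma flipH1_polarTarget {τ : ℝ} (hτ : τ = 1 ∨ τ = -1) {r a b : ℝ} (hr : r ≠ 0) (ha : 0 < a)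
    (hb : 0 < b) (α γ : ℝ) :
    flipH1 τ (polarTarget r a b α γ) = (a, b, a * b * Real.cos (α - τ * γ)) := by
  obtain ⟨e1, -, -, -, e5⟩ := polarTarget_lengths r a b α γ
  have k1 : d1 (polarTarget r a b α γ) = a := (sq_eq_sq₀ (norm_nonneg _) ha.le).1 e1
  have k5 : d5 (polarTarget r a b α γ) = b := (sq_eq_sq₀ (norm_nonneg _) hb.le).1 e5
  rw [flipH1, flipInner_polarTarget hτ hr, k1, k5]

/-- The values of `(‖z₁‖, ‖z₅‖, z₁ᵀz₅)` at noncollinear positions. -/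
def admissible : Set (ℝ × ℝ × ℝ) := {p | 0 < p.1 ∧ 0 < p.2.1 ∧ |p.2.2| < p.1 * p.2.1}

lemma isOpen_admissible : IsOpen admissible := by
  have h1 : IsOpen {p : ℝ × ℝ × ℝ | 0 < p.1} := isOpen_lt (by fun_prop) (by fun_prop)
  have h2 : IsOpen {p : ℝ × ℝ × ℝ | 0 < p.2.1} := isOpen_lt (by fun_prop) (by fun_prop)
  have h3 : IsOpen {p : ℝ × ℝ × ℝ | |p.2.2| < p.1 * p.2.1} := isOpen_lt (by fun_prop) (by fun_prop)
  exact h1.inter (h2.inter h3)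

lemma exists_angle {a b s : ℝ} (ha : 0 < a) (hb : 0 < b) (hs : |s| < a * b) :
    ∃ θ, 0 < θ ∧ θ < Real.pi ∧ s = a * b * Real.cos θ := by
  have hab := mul_pos ha hb
  obtain ⟨h1, h2⟩ := abs_lt.1 hs
  have h1' : -1 < s / (a * b) := by rw [lt_div_iff₀ hab]; linarith
  have h2' : s / (a * b) < 1 := by rw [div_lt_iff₀ hab]; linarith
  refine ⟨Real.arccos (s / (a * b)), Real.arccos_pos.2 h2', ?_, ?_⟩
  · refine lt_of_le_of_ne (Real.arccos_le_pi _) fun h => ?_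
    have := Real.arccos_eq_pi.1 h
    linarith
  · rw [Real.cos_arccos h1'.le h2'.le]; field_simp

lemma h1_mem_admissible {x : Configuration} (hG : gainDet x ≠ 0) : h1 x ∈ admissible := by
  obtain ⟨-, -, n1, n2, n3, n4, n5⟩ := ne_zero_of_gainDet_ne_zero hG
  refine ⟨norm_pos_iff.2 n1, norm_pos_iff.2 n5, ?_⟩
  have hc : cross (z1 x) (z5 x) ≠ 0 := fun h0 => hG (by simp [gainDet, h0])
  change |inner ℝ (z1 x) (z5 x)| < ‖z1 x‖ * ‖z5 x‖
  refine abs_lt_of_sq_lt_sq ?_ (by positivity)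
  have : inner ℝ (z1 x) (z5 x) ^ 2 + cross (z1 x) (z5 x) ^ 2 = (‖z1 x‖ * ‖z5 x‖) ^ 2 := by
    rw [mul_pow, norm_sq_plane, norm_sq_plane, inner_plane, cross]; ring
  have : 0 < cross (z1 x) (z5 x) ^ 2 := by positivity
  linarith

/-- Place agent 4 almost on the line `x₁x₃`, at angle `t`. The two flips then show agent 1 the
angles `θ - t` and `θ + t`, both close to `θ`, so either one serves. -/
lemma exists_stable_h1_mem {u : Feedback} (H : Dense (stablyRealized u)) {p : ℝ × ℝ × ℝ}
    (hp : p ∈ admissible) {N : Set (ℝ × ℝ × ℝ)} (hN : N ∈ 𝓝 p) :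
    ∃ μ x, x ∈ stableEquilibria u μ ∧ x ∈ designEquilibria μ ∧ gainDet x ≠ 0 ∧ h1 x ∈ N := by
  obtain ⟨a, b, s⟩ := p
  obtain ⟨ha, hb, hs⟩ := hp
  simp only at ha hb hs
  obtain ⟨θ, h0, hπ, rfl⟩ := exists_angle ha hb hs
  have hsin : 0 < Real.sin θ := Real.sin_pos_of_pos_of_lt_pi h0 hπ
  -- This keeps `x₄` away from `x₃`: their squared distance tends to `(r - b) ^ 2 = 1` as `t → 0`,
  -- so the last factor of `flipDet` tends to `a * sin θ ≠ 0`.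
  set r := b + 1 with hr
  have hr0 : r ≠ 0 := by positivity
  have key (τ : ℝ) (hτ : τ = 1 ∨ τ = -1) : ∀ᶠ t in 𝓝[>] (0 : ℝ),
      flipDet τ (polarTarget r a b θ t).framework ≠ 0 ∧
      ∀ᶠ q in 𝓝 (flipH1 τ (polarTarget r a b θ t)), q ∈ N := by
    have c1 : Filter.Tendsto (fun t => Real.sin (θ - τ * t)) (𝓝 0) (𝓝 (Real.sin θ)) := by
      have : Continuous fun t => Real.sin (θ - τ * t) := by fun_prop
      simpa using this.tendsto 0
    have c2 : Filter.Tendsto (fun t => a * Real.sin θ * (r ^ 2 + b ^ 2 - 2 * r * b * Real.cos t) -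
        τ * b * Real.sin t * (r ^ 2 + a ^ 2 - 2 * r * a * Real.cos θ)) (𝓝 0)
        (𝓝 (a * Real.sin θ)) := by
      have : Continuous fun t => a * Real.sin θ * (r ^ 2 + b ^ 2 - 2 * r * b * Real.cos t) -
        τ * b * Real.sin t * (r ^ 2 + a ^ 2 - 2 * r * a * Real.cos θ) := by fun_prop
      have h := this.tendsto 0
      have e : r ^ 2 + b ^ 2 - 2 * r * b = 1 := by rw [hr]; ring
      simpa [e] using h
    have c3 : Filter.Tendsto (fun t => (a, b, a * b * Real.cos (θ - τ * t))) (𝓝 0)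
        (𝓝 (a, b, a * b * Real.cos θ)) := by
      have : Continuous fun t => (a, b, a * b * Real.cos (θ - τ * t)) := by fun_prop
      simpa using this.tendsto 0
    have hτ0 : τ ≠ 0 := by rcases hτ with rfl | rfl <;> norm_num
    filter_upwards [nhdsWithin_le_nhds (c1.eventually_ne hsin.ne'),
      nhdsWithin_le_nhds (c2.eventually_ne (mul_pos ha hsin).ne'),
      nhdsWithin_le_nhds (c3.eventually (eventually_eventually_nhds.2 hN)),
      Ioo_mem_nhdsGT Real.pi_pos] with t t1 t2 t3 t4
    have hsint := (Real.sin_pos_of_pos_of_lt_pi t4.1 t4.2).ne'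
    refine ⟨?_, ?_⟩
    · rw [flipDet_polarTarget hτ]
      refine mul_ne_zero (mul_ne_zero (neg_ne_zero.2 ?_) t1) t2
      positivity
    · rw [flipH1_polarTarget hτ hr0 ha hb]
      exact t3
  obtain ⟨t, ⟨dp, np⟩, dm, nm⟩ := ((key 1 (.inl rfl)).and (key (-1) (.inr rfl))).exists
  have h3 := z3_ne_zero_of_flipDet dp
  obtain ⟨μ, x, τ, ⟨hPp, hPm⟩, hs, hx, hG, hτ, -, hh⟩ := exists_stable_near H dp dm
    (((continuousAt_flipH1 1 h3).eventually np).and ((continuousAt_flipH1 (-1) h3).eventually nm))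
  refine ⟨μ, x, hs, hx, hG, ?_⟩
  rw [hh]
  rcases hτ with rfl | rfl
  · exact hPp
  · exact hPm

/-! ### The gains of agent 1 -/

lemma continuous_designPoint : Continuous designPoint := by unfold designPoint; fun_prop

/-- Changing `z1ᵀz5` alone moves from one design point to another, because the known target data
contain only the two lengths. -/
lemma fderiv_inner_direction_eq_zero {f : SmoothFn ((ℝ × ℝ) × (ℝ × ℝ × ℝ))}
    (hf : ∀ p ∈ admissible, f.1 (designPoint p) = 0) {p : ℝ × ℝ × ℝ} (hp : p ∈ admissible) :
    fderiv ℝ f.1 (designPoint p) (0, 0, 0, 1) = 0 := by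
  have hl : HasDerivAt (fun t : ℝ => designPoint p + t • ((0 : ℝ × ℝ), (0 : ℝ), (0 : ℝ), (1 : ℝ)))
      (0, 0, 0, 1) 0 := by
    simpa using ((hasDerivAt_id (0 : ℝ)).smul_const
      ((0 : ℝ × ℝ), (0 : ℝ), (0 : ℝ), (1 : ℝ))).const_add (designPoint p)
  have hf' := f.hasFDerivAt (designPoint p + (0 : ℝ) • ((0 : ℝ × ℝ), (0 : ℝ), (0 : ℝ), (1 : ℝ)))
  have h := hf'.comp_hasDerivAt (0 : ℝ) hl
  rw [zero_smul, add_zero] at h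
  have hc : Continuous fun t : ℝ => ((p.1, p.2.1, p.2.2 + t) : ℝ × ℝ × ℝ) := by fun_prop
  have hev : ∀ᶠ t in 𝓝 (0 : ℝ), (p.1, p.2.1, p.2.2 + t) ∈ admissible :=
    hc.continuousAt.eventually (isOpen_admissible.mem_nhds (by simpa using hp))
  refine h.unique ((hasDerivAt_const (0 : ℝ) (0 : ℝ)).congr_of_eventuallyEq ?_)
  filter_upwards [hev] with t ht
  have e : designPoint p + t • ((0 : ℝ × ℝ), (0 : ℝ), (0 : ℝ), (1 : ℝ)) =
      designPoint (p.1, p.2.1, p.2.2 + t) := by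
    obtain ⟨a, b, c⟩ := p
    simp [designPoint]
  rw [Function.comp_apply, e, hf _ ht]

/-- Otherwise some gain would be nonzero on an open set of design points, one of which is realized
by a stable, nondegenerate design equilibrium, where all gains vanish. -/
lemma leader_eq_zero {u : Feedback} (H : Dense (stablyRealized u)) {p : ℝ × ℝ × ℝ}
    (hp : p ∈ admissible) :
    u.u11.1 (designPoint p) = 0 ∧ u.u12.1 (designPoint p) = 0 := by
  by_contra hne
  have hopen : IsOpen {p | ¬(u.u11.1 (designPoint p) = 0 ∧ u.u12.1 (designPoint p) = 0)} := by
    have k1 := u.u11.2.continuous.comp continuous_designPoint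
    have k2 := u.u12.2.continuous.comp continuous_designPoint
    exact ((isClosed_eq k1 continuous_const).inter (isClosed_eq k2 continuous_const)).isOpen_compl
  obtain ⟨μ, x, hs, hx, hG, hh⟩ := exists_stable_h1_mem H hp (hopen.mem_nhds hne)
  obtain ⟨a, b, L, hL, hv, -⟩ := hs
  have hg := gains_eq_zero hG hv
  have e : (δ1 μ, h1 x) = designPoint (h1 x) := by
    simp [designPoint, δ1, h1, hx.1, hx.2.2.2.2]
  refine hh ⟨?_, ?_⟩
  · rw [← e]; exact congrFun hg 0
  · rw [← e]; exact congrFun hg 1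

lemma stable_sign {u : Feedback} (H : Dense (stablyRealized u)) {μ : Target} {x : Configuration}
    (hs : x ∈ stableEquilibria u μ) (hx : x ∈ designEquilibria μ) (hG : gainDet x ≠ 0) :
    0 < gainDet x * (leaderJacobian u (h1 x) * followerSlope u ‖z2 x‖ ‖z3 x‖ ‖z4 x‖) :=
  gainDet_mul_pos hs hx hG
    (fderiv_inner_direction_eq_zero (fun _ hp => (leader_eq_zero H hp).1) (h1_mem_admissible hG))
    (fderiv_inner_direction_eq_zero (fun _ hp => (leader_eq_zero H hp).2) (h1_mem_admissible hG))

lemma SmoothFn.continuous_fderiv_apply {E : Type} [NormedAddCommGroup E] [NormedSpace ℝ E]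
    (f : SmoothFn E) {X : Type} [TopologicalSpace X] {g : X → E} (hg : Continuous g) (v : E) :
    Continuous fun p => fderiv ℝ f.1 (g p) v :=
  ((f.2.continuous_fderiv (by simp)).comp hg).clm_apply continuous_const

lemma continuous_leaderJacobian (u : Feedback) : Continuous (leaderJacobian u) := by
  have h := fun f : SmoothFn ((ℝ × ℝ) × (ℝ × ℝ × ℝ)) =>
    f.continuous_fderiv_apply continuous_designPoint
  exact ((h u.u11 _).mul (h u.u12 _)).sub ((h u.u11 _).mul (h u.u12 _))

lemma continuous_followerSlope (u : Feedback) :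
    Continuous fun p : ℝ × ℝ × ℝ => followerSlope u p.1 p.2.1 p.2.2 := by
  exact ((u.u2.continuous_fderiv_apply (by fun_prop) _).mul
    (u.u3.continuous_fderiv_apply (by fun_prop) _)).mul
    (u.u4.continuous_fderiv_apply (by fun_prop) _)

lemma exists_leaderJacobian_ne_zero {u : Feedback} (H : Dense (stablyRealized u)) {p : ℝ × ℝ × ℝ}
    (hp : p ∈ admissible) {N : Set (ℝ × ℝ × ℝ)} (hN : N ∈ 𝓝 p) :
    ∃ q ∈ N, q ∈ admissible ∧ leaderJacobian u q ≠ 0 := by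
  obtain ⟨μ, x, hs, hx, hG, hh⟩ := exists_stable_h1_mem H hp hN
  refine ⟨h1 x, hh, h1_mem_admissible hG, fun h0 => ?_⟩
  have := stable_sign H hs hx hG
  simp [h0] at this

/-! ### Targets both of whose flips are unstable -/

/-- There are a triangle `x₁x₃x₂` and a triangle `x₁x₃x₄`, both with a right angle at `x₁`, on
whose sides the slopes of `u₂`, `u₃`, `u₄` do not vanish. -/
lemma exists_right_triangles {u : Feedback} (H : Dense (stablyRealized u)) :
    ∃ r a b : ℝ, 0 < r ∧ 0 < a ∧ 0 < b ∧ a * (r ^ 2 + b ^ 2) - b * (r ^ 2 + a ^ 2) ≠ 0 ∧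
      followerSlope u √(r ^ 2 + a ^ 2) r √(r ^ 2 + b ^ 2) ≠ 0 := by
  -- The lengths `d2`, `d3`, `d4` are those of right triangles with legs `1, 2` and `1, 3`. Since
  -- two right angles at `x₁` would make `z1` and `z5` collinear and `gainDet` zero, `x̄₂` is placed
  -- elsewhere at the same distance from `x̄₃`. This is harmless, as the follower slopes see only
  -- these three lengths.
  set μ₀ : Target := ![!₂[2, 2], !₂[1, 0], !₂[0, 3]] with hμ₀
  have e2 : d2 μ₀ ^ 2 = 5 := by
    rw [d2, norm_sq_plane]; simp [z2, Target.framework, hμ₀]; norm_num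
  have e3 : d3 μ₀ ^ 2 = 1 := by
    rw [d3, norm_sq_plane]; simp [z3, Target.framework, hμ₀]
  have e4 : d4 μ₀ ^ 2 = 10 := by
    rw [d4, norm_sq_plane]; simp [z4, Target.framework, hμ₀]; norm_num
  have hdet (τ : ℝ) (hτ : τ = 1 ∨ τ = -1) : flipDet τ μ₀.framework ≠ 0 := by
    rw [flipDet, ← d2, ← d4, e2, e4]
    simp [area2, area4, cross, inner_plane, z1, z5, Target.framework, hμ₀]
    rcases hτ with rfl | rfl <;> norm_num
  obtain ⟨-, c2, c3, c4, -⟩ := continuous_lengths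
  have hn (d : Target → ℝ) (hd : Continuous d) (c : ℝ) (hc : d μ₀ ^ 2 = c) :
      ∀ᶠ μ in 𝓝 μ₀, d μ ^ 2 ∈ Set.Ioo (c - 1 / 10) (c + 1 / 10) :=
    (hd.pow 2).continuousAt.eventually
      (Ioo_mem_nhds (by change _ < d μ₀ ^ 2; linarith) (by change d μ₀ ^ 2 < _; linarith))
  obtain ⟨μ, x, τ, ⟨⟨l2, g2⟩, ⟨l3, g3⟩, ⟨l4, g4⟩⟩, hs, hx, hG, -⟩ :=
    exists_stable_near H (hdet 1 (.inl rfl)) (hdet (-1) (.inr rfl))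
      ((hn d2 c2 5 e2).and ((hn d3 c3 1 e3).and (hn d4 c4 10 e4)))
  have hK := stable_sign H hs hx hG
  obtain ⟨-, f2, f3, f4, -⟩ := hx
  rw [f2, f3, f4] at hK
  have hr : 0 ≤ d3 μ := norm_nonneg _
  have hr0 : 0 < d3 μ := by
    refine lt_of_le_of_ne hr fun h => ?_
    rw [← h] at l3; norm_num at l3
  have ha : 0 < d2 μ ^ 2 - d3 μ ^ 2 := by linarith
  have hb : 0 < d4 μ ^ 2 - d3 μ ^ 2 := by linarith
  refine ⟨d3 μ, √(d2 μ ^ 2 - d3 μ ^ 2), √(d4 μ ^ 2 - d3 μ ^ 2), hr0, Real.sqrt_pos.2 ha,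
    Real.sqrt_pos.2 hb, ?_, ?_⟩
  · have sa := Real.sq_sqrt ha.le
    have sb := Real.sq_sqrt hb.le
    have pa := Real.sqrt_pos.2 ha
    have pb := Real.sqrt_pos.2 hb
    set a := √(d2 μ ^ 2 - d3 μ ^ 2)
    set b := √(d4 μ ^ 2 - d3 μ ^ 2)
    have k : a * (d3 μ ^ 2 + b ^ 2) - b * (d3 μ ^ 2 + a ^ 2) =
      (a - b) * (d3 μ ^ 2 - a * b) := by ring
    rw [k]
    -- Here `a ^ 2`, `b ^ 2`, `d3 μ ^ 2` are near `4`, `9`, `1`.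
    have hab : a < b := by nlinarith
    have hrab : d3 μ ^ 2 < a * b := by nlinarith
    exact mul_ne_zero (by linarith) (by linarith)
  · rw [Real.sq_sqrt ha.le, Real.sq_sqrt hb.le, add_sub_cancel, add_sub_cancel,
      Real.sqrt_sq (show 0 ≤ d2 μ from norm_nonneg _),
      Real.sqrt_sq (show 0 ≤ d4 μ from norm_nonneg _)]
    intro h0
    simp [h0] at hK

lemma exists_sign {s : ℝ} (hs : s ≠ 0) : ∃ σ : ℝ, (σ = 1 ∨ σ = -1) ∧ 0 < σ * s := by
  rcases lt_or_gt_of_ne hs with h | h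
  · exact ⟨-1, .inr rfl, by linarith⟩
  · exact ⟨1, .inl rfl, by linarith⟩

/-- An angle between `0` and `ε` at which, after a small change of the lengths, the Jacobian of
agent 1 does not vanish for the given sign of the cosine. -/
lemma exists_small_angle {u : Feedback} (H : Dense (stablyRealized u)) {a b ε σ : ℝ} (ha : 0 < a)
    (hb : 0 < b) (hε : 0 < ε) (hε1 : ε < 1) (hσ : σ = 1 ∨ σ = -1) {N : Set (ℝ × ℝ)}
    (hN : N ∈ 𝓝 (a, b)) :
    ∃ a' b' η, (a', b') ∈ N ∧ 0 < a' ∧ 0 < b' ∧ 0 < η ∧ η < ε ∧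
      leaderJacobian u (a', b', σ * (a' * b' * Real.cos η)) ≠ 0 := by
  have hπ := Real.pi_gt_three
  have hab := mul_pos ha hb
  have hσ2 : σ * σ = 1 := by rcases hσ with rfl | rfl <;> norm_num
  have hσa (t : ℝ) : |σ * t| = |t| := by rcases hσ with rfl | rfl <;> simp
  have c0 : Real.cos ε < Real.cos (ε / 2) :=
    Real.cos_lt_cos_of_nonneg_of_le_pi (by linarith) (by linarith) (by linarith)
  have c1 : Real.cos (ε / 2) < 1 := by
    rw [← Real.cos_zero]
    exact Real.cos_lt_cos_of_nonneg_of_le_pi le_rfl (by linarith) (by linarith)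
  have c2 : 0 < Real.cos (ε / 2) := Real.cos_pos_of_mem_Ioo ⟨by linarith, by linarith⟩
  -- Start from the angle `ε / 2`; a nearby point with nonzero Jacobian still has its angle in `(0,
  -- ε)`.
  have hp : (a, b, σ * (a * b * Real.cos (ε / 2))) ∈ admissible := by
    refine ⟨ha, hb, ?_⟩
    simp only [hσa]
    rw [abs_of_pos (by positivity)]
    nlinarith
  have hev : ∀ᶠ q : ℝ × ℝ × ℝ in 𝓝 (a, b, σ * (a * b * Real.cos (ε / 2))),
      (q.1, q.2.1) ∈ N ∧ q.1 * q.2.1 * Real.cos ε < σ * q.2.2 := by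
    refine Filter.Eventually.and ?_ ?_
    · have h : Continuous fun q : ℝ × ℝ × ℝ => (q.1, q.2.1) := by fun_prop
      exact h.continuousAt.eventually hN
    · refine (isOpen_lt (by fun_prop) (by fun_prop)).mem_nhds ?_
      change a * b * Real.cos ε < σ * (σ * (a * b * Real.cos (ε / 2)))
      rw [← mul_assoc, hσ2, one_mul]
      exact mul_lt_mul_of_pos_left c0 hab
  obtain ⟨⟨a', b', s⟩, ⟨hq, hs⟩, ⟨ha', hb', hs'⟩, hJ⟩ := exists_leaderJacobian_ne_zero H hp hev
  simp only at hs ha' hb' hs' hq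
  rw [← hσa] at hs'
  obtain ⟨η, h0, hηπ, he⟩ := exists_angle ha' hb' hs'
  refine ⟨a', b', η, hq, ha', hb', h0, ?_, ?_⟩
  · rw [he] at hs
    have h := lt_of_mul_lt_mul_left hs (mul_pos ha' hb').le
    by_contra hle
    exact absurd h (not_lt.2 (Real.cos_le_cos_of_nonneg_of_le_pi hε.le hηπ.le (not_lt.1 hle)))
  · rw [← he, ← mul_assoc, hσ2, one_mul]
    exact hJ

lemma not_dense_stablyRealized (u : Feedback) : ¬ Dense (stablyRealized u) := by
  intro H
  obtain ⟨r, a₀, b₀, hr, ha₀, hb₀, hdiff, hK⟩ := exists_right_triangles H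
  -- the follower slope, and its product with a factor of the determinant, in polar coordinates
  let D2 : ℝ × ℝ × ℝ × ℝ → ℝ := fun p => r ^ 2 + p.1 ^ 2 - 2 * r * p.1 * Real.cos p.2.2.1
  let D4 : ℝ × ℝ × ℝ × ℝ → ℝ := fun p => r ^ 2 + p.2.1 ^ 2 - 2 * r * p.2.1 * Real.cos p.2.2.2
  let K : ℝ × ℝ × ℝ × ℝ → ℝ := fun p => followerSlope u √(D2 p) r √(D4 p)
  let Φ : ℝ → ℝ × ℝ × ℝ × ℝ → ℝ := fun τ p =>
    K p * (p.1 * Real.sin p.2.2.1 * D4 p - τ * p.2.1 * Real.sin p.2.2.2 * D2 p)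
  have cD2 : Continuous D2 := by fun_prop
  have cD4 : Continuous D4 := by fun_prop
  have cK : Continuous K := (continuous_followerSlope u).comp
    (cD2.sqrt.prodMk (continuous_const.prodMk cD4.sqrt))
  have cΦ (τ : ℝ) : Continuous (Φ τ) := by fun_prop
  let p₀ : ℝ × ℝ × ℝ × ℝ := (a₀, b₀, Real.pi / 2, Real.pi / 2)
  have hΦ (τ : ℝ) (hτ : τ = 1 ∨ τ = -1) : Φ τ p₀ ≠ 0 := by
    have e2 : D2 p₀ = r ^ 2 + a₀ ^ 2 := by simp [D2, p₀]
    have e4 : D4 p₀ = r ^ 2 + b₀ ^ 2 := by simp [D4, p₀]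
    have e : Φ τ p₀ = followerSlope u √(r ^ 2 + a₀ ^ 2) r √(r ^ 2 + b₀ ^ 2) *
        (a₀ * (r ^ 2 + b₀ ^ 2) - τ * b₀ * (r ^ 2 + a₀ ^ 2)) := by
      simp only [Φ, K, e2, e4]
      simp [p₀]
    rw [e]
    refine mul_ne_zero hK ?_
    rcases hτ with rfl | rfl
    · simpa using hdiff
    · have : 0 < a₀ * (r ^ 2 + b₀ ^ 2) - -1 * b₀ * (r ^ 2 + a₀ ^ 2) := by
        have : 0 < a₀ * (r ^ 2 + b₀ ^ 2) + b₀ * (r ^ 2 + a₀ ^ 2) := by positivity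
        linarith
      exact this.ne'
  have hnear (τ : ℝ) (hτ : τ = 1 ∨ τ = -1) : ∀ᶠ p in 𝓝 p₀, 0 < Φ τ p * Φ τ p₀ :=
    ((cΦ τ).mul continuous_const).continuousAt.eventually_const_lt
      (mul_self_pos.2 (hΦ τ hτ))
  obtain ⟨ε₀, hε₀, hball⟩ := Metric.eventually_nhds_iff.1
    ((hnear 1 (.inl rfl)).and (hnear (-1) (.inr rfl)))
  obtain ⟨ε, hε, hεε, hε1⟩ : ∃ ε, 0 < ε ∧ ε ≤ ε₀ ∧ ε < 1 :=
    ⟨min ε₀ (1 / 2), by positivity, min_le_left _ _, by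
      have := min_le_right ε₀ (1 / 2); linarith⟩
  -- the angles of the target
  have hB : Metric.ball a₀ ε ×ˢ Metric.ball b₀ ε ∈ 𝓝 (a₀, b₀) :=
    prod_mem_nhds (Metric.ball_mem_nhds _ hε) (Metric.ball_mem_nhds _ hε)
  obtain ⟨a₁, b₁, η, hab₁, ha₁, hb₁, hη, hηε, hJ₁⟩ :=
    exists_small_angle H ha₀ hb₀ hε hε1 (.inl rfl) hB
  -- The second change of lengths must keep the first Jacobian nonzero at the fixed angle `η`.
  have hN : ∀ᶠ q : ℝ × ℝ in 𝓝 (a₁, b₁), q ∈ Metric.ball a₀ ε ×ˢ Metric.ball b₀ ε ∧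
      leaderJacobian u (q.1, q.2, 1 * (q.1 * q.2 * Real.cos η)) ≠ 0 := by
    refine Filter.Eventually.and ((Metric.isOpen_ball.prod Metric.isOpen_ball).mem_nhds hab₁) ?_
    have h : Continuous fun q : ℝ × ℝ =>
        leaderJacobian u (q.1, q.2, 1 * (q.1 * q.2 * Real.cos η)) :=
      (continuous_leaderJacobian u).comp (by fun_prop)
    exact h.continuousAt.eventually_ne hJ₁
  obtain ⟨a, b, ζ, ⟨⟨haε, hbε⟩, hJp⟩, ha, hb, hζ, hζε, hJm⟩ :=
    exists_small_angle H ha₁ hb₁ hε hε1 (.inr rfl) hN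
  simp only at haε hbε hJp
  -- The signs `σ` and `ρ` are free because the cosines of `α - γ = σ * η` and `α + γ = π + ρ * ζ`
  -- do not depend on them. They are chosen to give each flip the wrong determinant sign.
  obtain ⟨σ, hσ, hσpos⟩ := exists_sign (mul_ne_zero hJp (hΦ 1 (.inl rfl)))
  obtain ⟨ρ, hρ, hρpos⟩ := exists_sign (mul_ne_zero hJm (hΦ (-1) (.inr rfl)))
  have hπ := Real.pi_gt_three
  set α := Real.pi / 2 + (σ * η + ρ * ζ) / 2 with hα
  set γ := Real.pi / 2 + (-(σ * η) + ρ * ζ) / 2 with hγ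
  have hση : |σ * η| < ε := by
    rcases hσ with rfl | rfl <;> simpa [abs_of_pos hη] using hηε
  have hρζ : |ρ * ζ| < ε := by
    rcases hρ with rfl | rfl <;> simpa [abs_of_pos hζ] using hζε
  obtain ⟨s1, s2⟩ := abs_lt.1 hση
  obtain ⟨s3, s4⟩ := abs_lt.1 hρζ
  have hsα : 0 < Real.sin α :=
    Real.sin_pos_of_pos_of_lt_pi (by rw [hα]; linarith) (by rw [hα]; linarith)
  have hsγ : 0 < Real.sin γ :=
    Real.sin_pos_of_pos_of_lt_pi (by rw [hγ]; linarith) (by rw [hγ]; linarith)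
  have hp : dist ((a, b, α, γ) : ℝ × ℝ × ℝ × ℝ) p₀ < ε₀ := by
    refine lt_of_lt_of_le ?_ hεε
    simp only [p₀, Prod.dist_eq, max_lt_iff]
    refine ⟨haε, hbε, ?_, ?_⟩ <;> rw [Real.dist_eq, abs_lt] <;> constructor <;> linarith
  obtain ⟨hΦp, hΦm⟩ := hball hp
  have hsub : α - 1 * γ = σ * η := by rw [hα, hγ]; ring
  have hadd : α - -1 * γ = ρ * ζ + Real.pi := by rw [hα, hγ]; ring
  have hsη := Real.sin_pos_of_pos_of_lt_pi hη (by linarith)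
  have hsζ := Real.sin_pos_of_pos_of_lt_pi hζ (by linarith)
  have esub : Real.sin (α - 1 * γ) = σ * Real.sin η := by
    rw [hsub]; rcases hσ with rfl | rfl <;> simp
  have csub : Real.cos (α - 1 * γ) = Real.cos η := by
    rw [hsub]; rcases hσ with rfl | rfl <;> simp
  have eadd : Real.sin (α - -1 * γ) = -(ρ * Real.sin ζ) := by
    rw [hadd, Real.sin_add_pi]; rcases hρ with rfl | rfl <;> simp
  have cadd : Real.cos (α - -1 * γ) = -Real.cos ζ := by
    rw [hadd, Real.cos_add_pi]; rcases hρ with rfl | rfl <;> simp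
  -- at this target both flips have the wrong sign
  set μ₀ := polarTarget r a b α γ with hμ₀
  obtain ⟨-, q2, q3, q4, -⟩ := polarTarget_lengths r a b α γ
  have hK₀ : followerSlope u (d2 μ₀) (d3 μ₀) (d4 μ₀) = K (a, b, α, γ) := by
    have e2 : √(D2 (a, b, α, γ)) = d2 μ₀ := by
      rw [← Real.sqrt_sq (show 0 ≤ d2 μ₀ from norm_nonneg _), q2]
    have e4 : √(D4 (a, b, α, γ)) = d4 μ₀ := by
      rw [← Real.sqrt_sq (show 0 ≤ d4 μ₀ from norm_nonneg _), q4]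
    have e3 : d3 μ₀ = r := (sq_eq_sq₀ (norm_nonneg _) hr.le).1 q3
    simp only [K, e2, e4, e3]
  -- Up to the factor `‖z3 x‖ ^ 2`, this is the quantity that `stable_sign` makes positive at a
  -- stable framework of flip type `τ`.
  let Q : ℝ → Target → ℝ := fun τ μ => flipDet τ μ.framework *
    (leaderJacobian u (flipH1 τ μ) * followerSlope u (d2 μ) (d3 μ) (d4 μ))
  have hC : 0 < r ^ 5 * a ^ 2 * b ^ 2 * (Real.sin α * Real.sin γ) := by positivity
  have hQp : Q 1 μ₀ < 0 := by
    have hJ : 0 < σ * leaderJacobian u (a, b, 1 * (a * b * Real.cos η)) * Φ 1 (a, b, α, γ) := by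
      have := mul_pos hσpos hΦp
      have h2 : 0 < Φ 1 p₀ ^ 2 := by have := hΦ 1 (.inl rfl); positivity
      refine pos_of_mul_pos_left (b := Φ 1 p₀ ^ 2) ?_ h2.le
      linarith
    have e : Q 1 μ₀ = -(r ^ 5 * a ^ 2 * b ^ 2 * (Real.sin α * Real.sin γ) * Real.sin η *
        (σ * leaderJacobian u (a, b, 1 * (a * b * Real.cos η)) * Φ 1 (a, b, α, γ))) := by
      simp only [Q, hK₀]
      rw [hμ₀, flipDet_polarTarget (.inl rfl), flipH1_polarTarget (.inl rfl) hr.ne' ha hb, esub,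
        csub, one_mul (a * b * Real.cos η)]
      simp only [Φ, D2, D4]
      ring
    rw [e, neg_lt_zero]
    positivity
  have hQm : Q (-1) μ₀ < 0 := by
    have hJ : 0 < ρ * leaderJacobian u (a, b, -1 * (a * b * Real.cos ζ)) *
        Φ (-1) (a, b, α, γ) := by
      have := mul_pos hρpos hΦm
      have h2 : 0 < Φ (-1) p₀ ^ 2 := by have := hΦ (-1) (.inr rfl); positivity
      refine pos_of_mul_pos_left (b := Φ (-1) p₀ ^ 2) ?_ h2.le
      linarith
    have e : Q (-1) μ₀ = -(r ^ 5 * a ^ 2 * b ^ 2 * (Real.sin α * Real.sin γ) * Real.sin ζ *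
        (ρ * leaderJacobian u (a, b, -1 * (a * b * Real.cos ζ)) * Φ (-1) (a, b, α, γ))) := by
      simp only [Q, hK₀]
      rw [hμ₀, flipDet_polarTarget (.inr rfl), flipH1_polarTarget (.inr rfl) hr.ne' ha hb, eadd,
        cadd, show a * b * -Real.cos ζ = -1 * (a * b * Real.cos ζ) by ring]
      simp only [Φ, D2, D4]
      ring
    rw [e, neg_lt_zero]
    positivity
  have hne (τ : ℝ) (h : Q τ μ₀ < 0) : flipDet τ μ₀.framework ≠ 0 := by
    intro h0
    simp [Q, h0] at h
  have h3 := z3_ne_zero_of_flipDet (hne 1 hQp)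
  obtain ⟨-, c2, c3, c4, -⟩ := continuous_lengths
  have cQ (τ : ℝ) : ContinuousAt (Q τ) μ₀ :=
    ((continuous_flipDet τ).comp continuous_framework).continuousAt.mul
      (((continuous_leaderJacobian u).continuousAt.comp (continuousAt_flipH1 τ h3)).mul
        ((continuous_followerSlope u).comp (c2.prodMk (c3.prodMk c4))).continuousAt)
  -- Both inequalities are open, so density yields a target satisfying them that has a stable design
  -- equilibrium.
  obtain ⟨μ, x, τ, ⟨hp', hm'⟩, hs, hx, hG, hτ, hdet, hh⟩ := exists_stable_near H (hne 1 hQp)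
    (hne (-1) hQm) (((cQ 1).eventually_lt_const hQp).and ((cQ (-1)).eventually_lt_const hQm))
  have hpos := stable_sign H hs hx hG
  have hneg : Q τ μ < 0 := by
    rcases hτ with rfl | rfl
    · exact hp'
    · exact hm'
  simp only [Q] at hneg
  rw [← hdet, ← hh, ← hx.2.1, ← hx.2.2.1, ← hx.2.2.2.1, mul_assoc] at hneg
  exact absurd hneg (not_lt.2 (mul_nonneg (sq_nonneg _) hpos.le))

end

end TwoCycles

/-! ### Deduction of both claims from the failure of density. -/

theorem mainTheorem3 :
    (∀ r : ℕ∞, ¬ ∃ u : TwoCycles.Feedback,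
      TwoCycles.Robustly (TwoCycles.Feedback.crTopology r) TwoCycles.TypeAStable u) ∧
    (∀ u : TwoCycles.Feedback, ∃ O : Set TwoCycles.Target, IsOpen O ∧ O.Nonempty ∧
      ∀ μ ∈ O, (TwoCycles.stableEquilibria u μ).Nonempty →
        (TwoCycles.stableEquilibria u μ ∩ TwoCycles.ancillaryEquilibria u μ).Nonempty) := by
  have main (u : TwoCycles.Feedback) : ∃ O : Set TwoCycles.Target, IsOpen O ∧ O.Nonempty ∧
      ∀ μ ∈ O, (TwoCycles.stableEquilibria u μ).Nonempty →
        (TwoCycles.stableEquilibria u μ ∩ TwoCycles.ancillaryEquilibria u μ).Nonempty := by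
    refine ⟨(closure (TwoCycles.stablyRealized u))ᶜ, isClosed_closure.isOpen_compl, ?_, ?_⟩
    · rw [Set.nonempty_compl, Ne, ← dense_iff_closure_eq]
      exact TwoCycles.not_dense_stablyRealized u
    · rintro μ hμ ⟨x, hx⟩
      obtain ⟨a, b, L, hL, hv, -⟩ := id hx
      exact ⟨x, hx, ⟨a, b, hv⟩, fun hd => hμ (subset_closure ⟨x, hx, hd⟩)⟩
  refine ⟨?_, main⟩
  rintro r ⟨u, N, hN, hP⟩
  have hA : TwoCycles.TypeAStable u := hP u (@mem_of_mem_nhds _ (_) _ _ hN)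
  obtain ⟨O, hO, hne, h⟩ := main u
  -- A set of full measure is dense, hence meets `O`.
  obtain ⟨μ, hμO, hs, hd⟩ := (Measure.dense_of_ae hA).inter_open_nonempty O hO hne
  obtain ⟨x, hx, hxa⟩ := h μ hμO hs
  exact hxa.2 (hd hx)
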